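/- **Setting.** Let $G=(V,E)$ be a finite connected undirected graph with edge costs $c(e)>0$, vertex prizes $p(v)\ge 0$ and a root $r\in V$; parallel edges and loops are allowed. For a subgraph $H$ write $p(H)$ for the sum of the prizes of its vertices and $c(H)$ for the sum of the costs of its edges. A *rooted subtree* of $G$ is a subtree of $G$ containing $r$. Let $\chi=\max_{v\in V}\ell(v)$ be the eccentricity of the root, where $\ell(v)$ is the minimum cost of an $r$-$v$-path. For $B\ge 0$ let $\mathrm{Opt}(B)$ be a rooted subtree of maximum prize among those of cost at most $B$, and let $V^*=\{v\in V: p(v)>0\}$. An *incremental solution* is an ordering $\pi=(e_1,\dots,e_l)$ of a subset of $E$ such that for every $j\le l$ the root together with $e_1,\dots,e_j$ (and their ends) forms a rooted subtree, and the subtree obtained for $j=l$ contains all of $V^*$. For $B\ge0$, $\mathrm{Alg}(B)$ is the rooted subtree formed by $r$ and the edges $e_i$ with $\sum_{j\le i}c(e_j)\le B$. An algorithm is *$(\alpha,\mu)$-competitive* (with $\alpha\ge0$, $\mu\ge1$, where $\alpha$ may depend on the instance) if on every instance it produces an incremental solution for which $\mu\,p(\mathrm{Alg}(B+\alpha))\ge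 p(\mathrm{Opt}(B))$ for all $B\in\mathbb R_{\ge0}$. *Density-greedy algorithm* on a tree $T$ with root $r$: start with the empty sequence $\pi$. Let $\bar T$ be the subtree formed by $r$ and the edges of $\pi$, and let $T/\bar T$ be obtained from $T$ by contracting $\bar T$ into $r$ and setting the prize of $r$ to $0$. While the total prize of $T/\bar T$ is nonzero, choose an arbitrary inclusion-wise minimal element $T^*$ among the rooted subtrees of $T/\bar T$ of maximum density (prize divided by cost; density $0$ if there are no edges), and append to $\pi$ the edge of $T^*$ incident to $r$. Return $\pi$. *Capacity-scaling algorithm*: start with the empty sequence $\pi$. For $i=0,1,2,\dots$, as long as $\pi$ (together with $r$) does not span all of $V^*$: choose an arbitrary rooted subtree $T_i$ of $G$ of maximum prize among those of cost at most $2^i\chi$; run the density-greedy algorithm on $T_i$ with root $r$; append the resulting edges to $\pi$ in order, skipping every edge that is already in $\pi$, is parallel to an edge of $\pi$, or closes a cycle with edges of $\pi$. Return $\pi$. **Theorem.** For all choices made during its execution, the capacity-scaling algorithm terminates, and for every integer $\ell\ge1$ it is $$\Bigl((4\ell-1)\chi,\ \frac{2^{\ell+2}}{2^{\ell}-1}\Bigr)\text{-competitive}.$$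 In particular (for $\ell=1$) it is $(3\chi,8)$-competitive. -/

import Mathlib

namespace PrizeCollecting

open Relation

noncomputable section

/-! ### Multigraphs: paths, trees, contraction -/

section Graph

variable {V E : Type*}

/-- `IsWalk G x w y`: the list `w` of pairs (edge, next vertex) is a walk in `G` from `x` to `y`. -/
inductive IsWalk (G : Graph V E) : V → List (E × V) → V → Prop
  | nil {x : V} : x ∈ G.vertexSet → IsWalk G x [] x
  | cons {x y z : V} {e : E} {w : List (E × V)} :
      G.IsLink e x y → IsWalk G y w z → IsWalk G x ((e, y) :: w) z

/-- A path is a walk that visits no vertex twice. -/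
def IsPath (G : Graph V E) (x : V) (w : List (E × V)) (y : V) : Prop :=
  IsWalk G x w y ∧ (x :: w.map Prod.snd).Nodup

/-- A graph is connected if it is non-empty and any two of its vertices are joined by a chain of
adjacent vertices. -/
def IsConnected (G : Graph V E) : Prop :=
  G.vertexSet.Nonempty ∧ ∀ x ∈ G.vertexSet, ∀ y ∈ G.vertexSet, ReflTransGen G.Adj x y

/-- A graph is acyclic if no edge lies on a cycle, i.e. deleting an edge always separates its ends
(so there are no loops and no parallel edges either). -/
def IsAcyclic (G : Graph V E) : Prop :=
  ∀ e x y, G.IsLink e x y → ¬ ReflTransGen (G.deleteEdges {e}).Adj x y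

/-- A tree is a connected acyclic graph. -/
def IsTree (G : Graph V E) : Prop := IsConnected G ∧ IsAcyclic G

/-- `T` is a subtree of `G` that contains the root `r`. -/
def IsRootedSubtree (G : Graph V E) (r : V) (T : Graph V E) : Prop :=
  T ≤ G ∧ IsTree T ∧ r ∈ T.vertexSet

/-- The subgraph of `G` induced by the edge set `F`, always including the root `r`: its edges are
the edges of `G` in `F`, its vertices are their ends and `r`. -/
def edgeSpan (G : Graph V E) (r : V) (F : Set E) : Graph V E where
  vertexSet := {v | v = r ∨ ∃ e ∈ F, G.Inc e v}
  IsLink e x y := G.IsLink e x y ∧ e ∈ F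
  isLink_symm := fun _ _ => ⟨fun _ _ h => ⟨h.1.symm, h.2⟩⟩
  eq_or_eq_of_isLink_of_isLink := fun _ _ _ _ _ h h' => h.1.left_eq_or_eq h'.1
  left_mem_of_isLink := fun e _ _ h => Or.inr ⟨e, h.2, h.1.inc_left⟩

open Classical in
/-- The contracted graph `G / T`: the edges of `T` are removed and all vertices of `T` are
identified with the root `r`. Parallel edges and loops are kept. -/
def contract (G : Graph V E) (r : V) (T : Graph V E) : Graph V E :=
  (G.deleteEdges T.edgeSet).map (fun v => if v ∈ T.vertexSet then r else v)

open Classical in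
/-- The prizes in a contracted graph: the root has prize `0`, other prizes are unchanged. -/
def contractPrize (p : V → ℝ) (r : V) : V → ℝ := fun v => if v = r then 0 else p v

/-- The total prize of the vertices of a graph. -/
def totalPrize (p : V → ℝ) (H : Graph V E) : ℝ := ∑ᶠ v ∈ H.vertexSet, p v

/-- The total cost of the edges of a graph. -/
def totalCost (c : E → ℝ) (H : Graph V E) : ℝ := ∑ᶠ e ∈ H.edgeSet, c e

/-- The density of a rooted subtree, prize over cost. A tree without edges has cost `0`, hence
density `0` as division by `0` gives `0`. -/
def density (c : E → ℝ) (p : V → ℝ) (T : Graph V E) : ℝ := totalPrize p T / totalCost c T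

/-- `T` is a rooted subtree of `G` of maximum density. -/
def IsMaxDensity (G : Graph V E) (c : E → ℝ) (p : V → ℝ) (r : V) (T : Graph V E) : Prop :=
  IsRootedSubtree G r T ∧ ∀ T', IsRootedSubtree G r T' → density c p T' ≤ density c p T

/-- A min-max subtree is an inclusion-wise minimal rooted subtree of maximum density. -/
def IsMinMax (G : Graph V E) (c : E → ℝ) (p : V → ℝ) (r : V) (T : Graph V E) : Prop :=
  Minimal (IsMaxDensity G c p r) T

end Graph

/-! ### Nondeterministic algorithms -/

/-- The program that starts in `s₀` and repeats `step` until `halt` holds always terminates: it has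
no infinite run, and it never gets stuck in a state in which it has not halted. -/
def AlwaysHalts {σ : Type*} (step : σ → σ → Prop) (halt : σ → Prop) (s₀ : σ) : Prop :=
  (¬ ∃ s : ℕ → σ, s 0 = s₀ ∧ ∀ n, step (s n) (s (n + 1))) ∧
    ∀ s, ReflTransGen step s₀ s → halt s ∨ ∃ s', step s s'

/-! ### The density-greedy algorithm on a tree -/

section DensityGreedy

variable {V E : Type*}

/-- The graph `G / T̄`, where `T̄` is the subtree spanned by the edges in the current solution. -/
def residual (G : Graph V E) (r : V) (π : List E) : Graph V E :=
  contract G r (edgeSpan G r {e | e ∈ π})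

/-- The loop of the density-greedy algorithm ends when the residual graph has total prize `0`. -/
def GreedyHalt (G : Graph V E) (p : V → ℝ) (r : V) (π : List E) : Prop :=
  totalPrize (contractPrize p r) (residual G r π) = 0

/-- One iteration of the density-greedy algorithm: fix an arbitrary min-max subtree of the residual
graph and append its edge at the root to the solution. -/
def GreedyStep (G : Graph V E) (c : E → ℝ) (p : V → ℝ) (r : V) (π π' : List E) : Prop :=
  ¬ GreedyHalt G p r π ∧ ∃ (T : Graph V E) (e : E),
    IsMinMax (residual G r π) c (contractPrize p r) r T ∧ T.Inc e r ∧ π' = π ++ [e]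

/-- `π` is a possible output of the density-greedy algorithm on `G` with root `r`. -/
def GreedyOutput (G : Graph V E) (c : E → ℝ) (p : V → ℝ) (r : V) (π : List E) : Prop :=
  ReflTransGen (GreedyStep G c p r) [] π ∧ GreedyHalt G p r π

end DensityGreedy

/-! ### The incremental prize-collecting Steiner-tree problem -/

/-- An instance: a connected graph with positive edge costs, non-negative vertex prizes, and a root.
Finiteness is imposed on the types `V` and `E`. -/
structure Instance (V E : Type*) where
  graph : Graph V E
  cost : E → ℝ
  prize : V → ℝ
  root : V
  connected : IsConnected graph
  cost_pos : ∀ e ∈ graph.edgeSet, 0 < cost e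
  prize_nonneg : ∀ v ∈ graph.vertexSet, 0 ≤ prize v
  root_mem : root ∈ graph.vertexSet

namespace Instance

variable {V E : Type*} (I : Instance V E)

/-- The minimum cost of a path from the root to `v`. -/
def rootDist (v : V) : ℝ :=
  sInf {x | ∃ w, IsPath I.graph I.root w v ∧ x = (w.map fun s => I.cost s.1).sum}

/-- The eccentricity `χ` of the root. -/
def eccentricity : ℝ := sSup (I.rootDist '' I.graph.vertexSet)

/-- `T` is a maximum-prize rooted subtree of cost at most `B`. -/
def IsOpt (B : ℝ) (T : Graph V E) : Prop :=
  (IsRootedSubtree I.graph I.root T ∧ totalCost I.cost T ≤ B) ∧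
    ∀ T', IsRootedSubtree I.graph I.root T' → totalCost I.cost T' ≤ B →
      totalPrize I.prize T' ≤ totalPrize I.prize T

/-- The rooted subgraph spanned by the edges in the list `π`. -/
def span (π : List E) : Graph V E := edgeSpan I.graph I.root {e | e ∈ π}

/-- `π` spans all vertices of positive prize. -/
def SpansPrizes (π : List E) : Prop :=
  ∀ v ∈ I.graph.vertexSet, 0 < I.prize v → v ∈ (I.span π).vertexSet

/-- An incremental solution: an ordering of a subset of the edges, each of whose prefixes induces a
rooted subtree, and which spans all vertices of positive prize. -/
def IsIncrementalSolution (π : List E) : Prop :=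
  π.Nodup ∧ (∀ e ∈ π, e ∈ I.graph.edgeSet) ∧
    (∀ j ≤ π.length, IsRootedSubtree I.graph I.root (I.span (π.take j))) ∧ I.SpansPrizes π

/-- The part of the incremental solution `π` that is built with budget `B`: the rooted subtree
induced by the edges up to which the total cost of `π` is at most `B`. -/
def alg (π : List E) (B : ℝ) : Graph V E :=
  edgeSpan I.graph I.root
    {e | ∃ i, π[i]? = some e ∧ ((π.take (i + 1)).map I.cost).sum ≤ B}

/-- An algorithm, given by its set of possible outputs on the instance `I`, is
`(α, μ)`-competitive on `I` if it has an output, and every output `π` is an incremental solution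
with `μ * p(Alg(B + α)) ≥ p(Opt(B))` for every budget `B ≥ 0`. -/
def IsCompetitive (output : List E → Prop) (α μ : ℝ) : Prop :=
  0 ≤ α ∧ 1 ≤ μ ∧ (∃ π, output π) ∧ ∀ π, output π → I.IsIncrementalSolution π ∧
    ∀ B : ℝ, 0 ≤ B → ∀ T, I.IsOpt B T →
      totalPrize I.prize T ≤ μ * totalPrize I.prize (I.alg π (B + α))

/-! ### The capacity-scaling algorithm -/

/-- The ends of `e` are already joined by edges of `π`. This covers edges that are in `π`, that are
parallel to an edge of `π`, or that close a cycle with edges of `π`. -/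
def ClosesCycle (π : List E) (e : E) : Prop :=
  ∃ x y, I.graph.IsLink e x y ∧ ReflTransGen (I.span π).Adj x y

open Classical in
/-- Append `e` to `π` unless it is a double or parallel edge or closes a cycle. -/
def appendEdge (π : List E) (e : E) : List E := if I.ClosesCycle π e then π else π ++ [e]

/-- One iteration of the capacity-scaling algorithm in the state `(i, π)`: as long as `π` does not
span all vertices of positive prize, compute an optimum rooted subtree `T` for the budget `2 ^ i * χ`,
run the density-greedy algorithm on `T`, and append its edges one by one to `π`. -/
def ScalingStep (s s' : ℕ × List E) : Prop :=
  ¬ I.SpansPrizes s.2 ∧ ∃ (T : Graph V E) (ρ : List E),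
    I.IsOpt (2 ^ s.1 * I.eccentricity) T ∧ GreedyOutput T I.cost I.prize I.root ρ ∧
      s' = (s.1 + 1, ρ.foldl I.appendEdge s.2)

/-- `π` is a possible output of the capacity-scaling algorithm. -/
def ScalingOutput (π : List E) : Prop :=
  ∃ i : ℕ, ReflTransGen I.ScalingStep (0, []) (i, π) ∧ I.SpansPrizes π

/-- The capacity-scaling algorithm always terminates, and so does the density-greedy algorithm on
each rooted subtree. -/
def ScalingTerminates : Prop :=
  AlwaysHalts I.ScalingStep (fun s => I.SpansPrizes s.2) (0, []) ∧
    ∀ T, IsRootedSubtree I.graph I.root T →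
      AlwaysHalts (GreedyStep T I.cost I.prize I.root) (GreedyHalt T I.prize I.root) []

end Instance

end

end PrizeCollecting

/-! Phase `j` of the algorithm adds cost at most `2 ^ j * χ`. So after it the solution costs at most
`(2 ^ (j + 1) - 1) * χ` and contains all positive-prize vertices of an optimum for budget `2 ^ j *
χ` (`IsGoodState`). Of the density-greedy subroutine only this is used: it halts, grows a tree from
the root, and covers the positive prizes of its input. The densities play no role in the bound.

Given `B`, choose `j` with `2 ^ (j + 1) ≤ B / χ + 4ℓ < 2 ^ (j + 2)`. The left inequality says that
phase `j` fits into the budget `B + (4ℓ - 1)χ`; the right one says `B < 4M` for `M = (2 ^ j - ℓ)χ`.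
What remains is to compare the optima for `B` and `2 ^ j * χ` (`IsOpt.compare`).

A tree of cost at most `4M` has at most `ℓ` connected parts of total cost at most `M` that together
hold the fraction `(1 - 2⁻ˡ) / 4` of its prize (`Arborescence.exists_parts`). Joining each part to
the root costs at most `χ`, which gives a rooted tree of cost at most `M + ℓχ = 2 ^ j * χ`. Hence
the factor `4 / (1 - 2⁻ˡ)`.

The parts are extracted one at a time. If a tree costs at least `M / 2` and has density at least
`d`, then `Arborescence.hasDensePart` yields a connected part of cost at most `M`, density at least
`d` and prize at least `d * M / 2`. Taking such a part and recursing with the remaining budget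
halves the gap to the ideal fraction `M / D` (`greedy_bound`). -/

namespace PrizeCollecting

open Relation

noncomputable section

/-! ### Trees grown from the root edge by edge. -/

section Growth

variable {V E : Type*} {G H T : Graph V E} {r x y v : V} {e : E} {F F' : Set E} {L : List E}

/-- `x` and `y` are joined by a walk of `G` with all edges in `F`. -/
def Joined (G : Graph V E) (F : Set E) : V → V → Prop :=
  ReflTransGen fun x y => ∃ e ∈ F, G.IsLink e x y

lemma Joined.mono (h : F ⊆ F') (hxy : Joined G F x y) : Joined G F' x y :=
  ReflTransGen.mono (fun _ _ ⟨e, he, hl⟩ => ⟨e, h he, hl⟩) _ _ hxy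

lemma Joined.symm (h : Joined G F x y) : Joined G F y x := by
  induction h with
  | refl => exact .refl
  | tail _ h ih =>
    obtain ⟨e, he, hl⟩ := h
    exact .head ⟨e, he, hl.symm⟩ ih

lemma Joined.trans {z : V} (h : Joined G F x y) (h' : Joined G F y z) : Joined G F x z :=
  ReflTransGen.trans h h'

lemma Joined.of_isLink (he : e ∈ F) (h : G.IsLink e x y) : Joined G F x y :=
  ReflTransGen.single ⟨e, he, h⟩

lemma Joined.mono_graph (h : H ≤ G) (hxy : Joined H F x y) : Joined G F x y :=
  ReflTransGen.mono (fun _ _ ⟨e, he, hl⟩ => ⟨e, he, hl.mono h⟩) _ _ hxy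

lemma Joined.mem (h : Joined G F x y) (hx : x ∈ G.vertexSet) : y ∈ G.vertexSet := by
  induction h with
  | refl => exact hx
  | tail _ h _ =>
    obtain ⟨e, -, hl⟩ := h
    exact hl.right_mem

lemma joined_edgeSet : ReflTransGen G.Adj x y ↔ Joined G G.edgeSet x y := by
  have : G.Adj = fun x y => ∃ e ∈ G.edgeSet, G.IsLink e x y := by
    funext x y
    exact propext ⟨fun ⟨e, h⟩ => ⟨e, h.edge_mem, h⟩, fun ⟨e, _, h⟩ => ⟨e, h⟩⟩
  rw [Joined, this]

lemma mem_edgeSpan : v ∈ (edgeSpan G r F).vertexSet ↔ v = r ∨ ∃ e ∈ F, G.Inc e v := Iff.rfl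

lemma edgeSet_edgeSpan (h : F ⊆ G.edgeSet) : (edgeSpan G r F).edgeSet = F := by
  ext e
  constructor
  · intro he
    obtain ⟨x, y, h⟩ := Graph.exists_isLink_of_mem_edgeSet he
    exact h.2
  · intro he
    obtain ⟨x, y, h'⟩ := Graph.exists_isLink_of_mem_edgeSet (h he)
    exact Graph.IsLink.edge_mem (G := edgeSpan G r F) ⟨h', he⟩

lemma edgeSpan_vertexSet_mono (h : F ⊆ F') :
    (edgeSpan G r F).vertexSet ⊆ (edgeSpan G r F').vertexSet := by
  rintro v (rfl | ⟨e, he, hi⟩)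
  · exact Or.inl rfl
  · exact Or.inr ⟨e, h he, hi⟩

lemma joined_edgeSpan : ReflTransGen (edgeSpan G r F).Adj x y ↔ Joined G F x y := by
  have : (edgeSpan G r F).Adj = fun x y => ∃ e ∈ F, G.IsLink e x y := by
    funext x y
    exact propext ⟨fun ⟨e, h⟩ => ⟨e, h.2, h.1⟩, fun ⟨e, h, h'⟩ => ⟨e, h', h⟩⟩
  rw [Joined, this]

lemma joined_deleteEdges_edgeSpan :
    ReflTransGen ((edgeSpan G r F).deleteEdges {e}).Adj x y ↔ Joined G (F \ {e}) x y := by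
  have : ((edgeSpan G r F).deleteEdges {e}).Adj = fun x y => ∃ f ∈ F \ {e}, G.IsLink f x y := by
    funext x y
    refine propext ⟨fun ⟨f, h⟩ => ?_, fun ⟨f, h, h'⟩ => ⟨f, ?_⟩⟩
    · rw [Graph.deleteEdges_isLink] at h
      exact ⟨f, ⟨h.1.2, h.2⟩, h.1.1⟩
    · rw [Graph.deleteEdges_isLink]
      exact ⟨⟨h', h.1⟩, h.2⟩
  rw [Joined, this]

/-- A walk that traverses the new edge repeatedly can be shortcut, so one traversal, in one of the
two directions, is enough. -/
lemma Joined.of_insert {a b : V} (hl : G.IsLink e x y) (h : Joined G (insert e F) a b) :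
    Joined G F a b ∨ (Joined G F a x ∧ Joined G F y b) ∨ (Joined G F a y ∧ Joined G F x b) := by
  induction h with
  | refl => exact Or.inl .refl
  | @tail b c _ h ih =>
    obtain ⟨f, rfl | hf, hbc⟩ := h
    · obtain ⟨rfl, rfl⟩ | ⟨rfl, rfl⟩ := hl.eq_and_eq_or_eq_and_eq hbc
      · rcases ih with h | ⟨h, -⟩ | ⟨h, -⟩
        · exact Or.inr (Or.inl ⟨h, .refl⟩)
        · exact Or.inr (Or.inl ⟨h, .refl⟩)
        · exact Or.inl h
      · rcases ih with h | ⟨h, -⟩ | ⟨h, -⟩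
        · exact Or.inr (Or.inr ⟨h, .refl⟩)
        · exact Or.inl h
        · exact Or.inr (Or.inr ⟨h, .refl⟩)
    · have := Joined.of_isLink hf hbc
      rcases ih with h | ⟨h, h'⟩ | ⟨h, h'⟩
      · exact Or.inl (h.trans this)
      · exact Or.inr (Or.inl ⟨h, h'.trans this⟩)
      · exact Or.inr (Or.inr ⟨h, h'.trans this⟩)

lemma mem_edgeSpan_of_joined (hx : x ∈ (edgeSpan G r F).vertexSet) (h : Joined G F x y) :
    y ∈ (edgeSpan G r F).vertexSet := by
  induction h with
  | refl => exact hx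
  | tail _ h _ =>
    obtain ⟨e, he, hl⟩ := h
    exact Or.inr ⟨e, he, hl.inc_right⟩

lemma isRootedSubtree_edgeSpan_empty (hr : r ∈ G.vertexSet) :
    IsRootedSubtree G r (edgeSpan G r ∅) := by
  have hv : ∀ v ∈ (edgeSpan G r (∅ : Set E)).vertexSet, v = r := by
    rintro v (h | ⟨e, he, -⟩)
    · exact h
    · exact he.elim
  refine ⟨⟨fun v h => hv v h ▸ hr, fun _ _ _ h => h.1⟩, ⟨⟨⟨r, Or.inl rfl⟩, ?_⟩, ?_⟩, Or.inl rfl⟩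
  · intro x hx y hy
    rw [hv x hx, hv y hy]
  · rintro e x y ⟨-, h⟩
    exact h.elim

lemma IsRootedSubtree.joined (h : IsRootedSubtree G r (edgeSpan G r F))
    (hx : x ∈ (edgeSpan G r F).vertexSet) (hy : y ∈ (edgeSpan G r F).vertexSet) :
    Joined G F x y :=
  joined_edgeSpan.1 (h.2.1.1.2 x hx y hy)

/-- Attaching a new leaf to a rooted subtree gives a rooted subtree. -/
lemma IsRootedSubtree.insert (h : IsRootedSubtree G r (edgeSpan G r F)) (hl : G.IsLink e x y)
    (hx : x ∈ (edgeSpan G r F).vertexSet) (hy : y ∉ (edgeSpan G r F).vertexSet) :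
    IsRootedSubtree G r (edgeSpan G r (insert e F)) := by
  have hr : r ∈ (edgeSpan G r F).vertexSet := Or.inl rfl
  have hsub : F ⊆ Insert.insert e F := Set.subset_insert _ _
  have hj : ∀ v ∈ (edgeSpan G r (Insert.insert e F)).vertexSet,
      Joined G (Insert.insert e F) r v := by
    have hrx := (h.joined hr hx).mono hsub
    rintro v (rfl | ⟨f, rfl | hf, hi⟩)
    · exact .refl
    · rcases hi.eq_or_eq_of_isLink hl with rfl | rfl
      · exact hrx
      · exact hrx.trans (.of_isLink (Set.mem_insert _ _) hl)
    · exact (h.joined hr (Or.inr ⟨f, hf, hi⟩)).mono hsub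
  have hle : edgeSpan G r (Insert.insert e F) ≤ G :=
    ⟨fun v hv => (hj v hv).mem (h.1.1 hr), fun _ _ _ h => h.1⟩
  have hxy : ¬ Joined G F x y := fun h' => hy (mem_edgeSpan_of_joined hx h')
  have heF : e ∉ F := fun he => hy (Or.inr ⟨e, he, hl.inc_right⟩)
  refine ⟨hle, ⟨⟨⟨r, Or.inl rfl⟩, fun a ha b hb => ?_⟩, fun f a b hf hab => ?_⟩, Or.inl rfl⟩
  · exact joined_edgeSpan.2 ((hj a ha).symm.trans (hj b hb))
  · rw [joined_deleteEdges_edgeSpan] at hab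
    obtain ⟨hf, rfl | hfF⟩ := hf
    · have h2 : Joined G F a b := hab.mono (by simp)
      obtain ⟨rfl, rfl⟩ | ⟨rfl, rfl⟩ := hl.eq_and_eq_or_eq_and_eq hf
      · exact hxy h2
      · exact hxy h2.symm
    · have hne : e ≠ f := fun h => heF (h ▸ hfF)
      have hd : Insert.insert e F \ {f} = Insert.insert e (F \ {f}) := by
        ext g
        simp only [Set.mem_sdiff, Set.mem_insert_iff, Set.mem_singleton_iff]
        constructor
        · tauto
        · rintro (rfl | h)
          · exact ⟨Or.inl rfl, hne⟩
          · exact ⟨Or.inr h.1, h.2⟩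
      rw [hd] at hab
      have hs : F \ {f} ⊆ F := Set.sdiff_subset
      have hba : Joined G F a b := .of_isLink hfF hf
      -- A connection of `a` and `b` without `f` either stays in `F`, against acyclicity, or crosses
      -- `e`. In the latter case, closing it up with `f` joins `x` to `y` inside `F`, although `y`
      -- is new.
      rcases hab.of_insert hl with h' | ⟨h1, h2⟩ | ⟨h1, h2⟩
      · exact h.2.1.2 f a b ⟨hf, hfF⟩ (joined_deleteEdges_edgeSpan.2 h')
      · exact hxy (((h1.mono hs).symm.trans hba).trans (h2.mono hs).symm)
      · exact hxy (((h2.mono hs).trans hba.symm).trans (h1.mono hs))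

/-- Edge lists that grow a tree from the root: every edge attaches a new vertex to the tree spanned
by the previous edges. -/
inductive IsGrowth (G : Graph V E) (r : V) : List E → Prop
  | nil : r ∈ G.vertexSet → IsGrowth G r []
  | snoc {L : List E} {e : E} {x y : V} : IsGrowth G r L → G.IsLink e x y →
      x ∈ (edgeSpan G r {f | f ∈ L}).vertexSet → y ∉ (edgeSpan G r {f | f ∈ L}).vertexSet →
      IsGrowth G r (L ++ [e])

lemma setOf_mem_append_singleton (L : List E) (e : E) :
    {f | f ∈ L ++ [e]} = insert e {f | f ∈ L} := by
  ext f
  simp [or_comm]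

lemma IsGrowth.isRootedSubtree (h : IsGrowth G r L) :
    IsRootedSubtree G r (edgeSpan G r {f | f ∈ L}) := by
  induction h with
  | nil hr =>
    have : {f : E | f ∈ ([] : List E)} = ∅ := by ext; simp
    rw [this]
    exact isRootedSubtree_edgeSpan_empty hr
  | snoc _ hl hx hy ih =>
    rw [setOf_mem_append_singleton]
    exact ih.insert hl hx hy

lemma IsGrowth.root_mem (h : IsGrowth G r L) : r ∈ G.vertexSet :=
  h.isRootedSubtree.1.1 (Or.inl rfl)

lemma IsGrowth.nodup (h : IsGrowth G r L) : L.Nodup := by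
  induction h with
  | nil => exact List.nodup_nil
  | snoc _ hl _ hy ih =>
    rw [List.nodup_append]
    refine ⟨ih, List.nodup_singleton _, ?_⟩
    rintro a ha b hb rfl
    rw [List.mem_singleton] at hb
    subst hb
    exact hy (Or.inr ⟨_, ha, hl.inc_right⟩)

lemma IsGrowth.subset (h : IsGrowth G r L) : ∀ e ∈ L, e ∈ G.edgeSet := by
  induction h with
  | nil => simp
  | snoc _ hl _ _ ih =>
    intro f hf
    rcases List.mem_append.1 hf with hf | hf
    · exact ih f hf
    · rw [List.mem_singleton.1 hf]
      exact hl.edge_mem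

lemma IsGrowth.take (h : IsGrowth G r L) (j : ℕ) : IsGrowth G r (L.take j) := by
  induction h with
  | nil hr => simpa using IsGrowth.nil hr
  | @snoc L e x y h hl hx hy ih =>
    rcases le_or_gt j L.length with hj | hj
    · rwa [List.take_append_of_le_length hj]
    · rw [List.take_of_length_le (by simpa using hj)]
      exact .snoc h hl hx hy

lemma IsGrowth.mono (h : IsGrowth H r L) (hHG : H ≤ G) : IsGrowth G r L := by
  have key : ∀ {L : List E}, IsGrowth H r L → (edgeSpan G r {f | f ∈ L}).vertexSet =
      (edgeSpan H r {f | f ∈ L}).vertexSet := by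
    intro L hL
    ext v
    simp only [mem_edgeSpan]
    refine or_congr_right (exists_congr fun f => and_congr_right fun hf => ?_)
    exact (hHG.inc_congr (hL.subset f hf)).symm
  induction h with
  | nil hr => exact .nil (hHG.1 hr)
  | snoc h hl hx hy ih => exact .snoc ih (hl.mono hHG) (key h ▸ hx) (key h ▸ hy)

/-- Every edge set contains a tree that spans everything it joins to the root. -/
lemma exists_isGrowth [Finite E] (hr : r ∈ G.vertexSet) (F : Set E) :
    ∃ L, IsGrowth G r L ∧ (∀ e ∈ L, e ∈ F) ∧
      ∀ v, Joined G F r v → v ∈ (edgeSpan G r {f | f ∈ L}).vertexSet := by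
  classical
  have := Fintype.ofFinite E
  let P : ℕ → Prop := fun n => ∃ L, IsGrowth G r L ∧ (∀ e ∈ L, e ∈ F) ∧ L.length = n
  have hP0 : P 0 := ⟨[], .nil hr, by simp, rfl⟩
  have hb : ∀ n, P n → n ≤ Fintype.card E := by
    rintro n ⟨L, hL, -, rfl⟩
    exact hL.nodup.length_le_card
  -- A longest growth inside `F` works: any edge of `F` leaving its span would extend it.
  obtain ⟨L, hL, hLF, hlen⟩ := Nat.findGreatest_spec (P := P) (Nat.zero_le (Fintype.card E)) hP0
  refine ⟨L, hL, hLF, fun v hv => ?_⟩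
  by_contra hcon
  have : ∃ x y, (∃ e ∈ F, G.IsLink e x y) ∧ x ∈ (edgeSpan G r {f | f ∈ L}).vertexSet ∧
      y ∉ (edgeSpan G r {f | f ∈ L}).vertexSet := by
    by_contra! hno
    apply hcon
    clear hcon
    induction hv with
    | refl => exact Or.inl rfl
    | tail _ h ih => exact hno _ _ h ih
  obtain ⟨x, y, ⟨e, he, hl⟩, hx, hy⟩ := this
  have h1 : P (L.length + 1) := by
    refine ⟨L ++ [e], .snoc hL hl hx hy, fun f hf => ?_, by simp⟩
    rcases List.mem_append.1 hf with hf | hf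
    · exact hLF f hf
    · rwa [List.mem_singleton.1 hf]
  have := Nat.le_findGreatest (P := P) (hb _ h1) h1
  omega

lemma IsRootedSubtree.exists_isGrowth [Finite E] (h : IsRootedSubtree G r T) :
    ∃ L, IsGrowth T r L ∧ (edgeSpan T r {f | f ∈ L}).vertexSet = T.vertexSet := by
  obtain ⟨L, hL, -, hv⟩ := PrizeCollecting.exists_isGrowth h.2.2 T.edgeSet
  refine ⟨L, hL, Set.Subset.antisymm hL.isRootedSubtree.1.1 fun v hvT => hv v ?_⟩
  exact joined_edgeSet.1 (h.2.1.1.2 r h.2.2 v hvT)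

end Growth

/-! ### Extracting dense connected parts from a tree. -/

section Decomposition

variable {V E : Type*} {G : Graph V E} {v x y : V} {e : E} {L : List E} {W : Finset V}

open Classical in
/-- Trees with root `v`, edge list `L` and vertex set `W`, built from single vertices by joining the
roots of two disjoint trees with an edge. -/
inductive Arborescence (G : Graph V E) : V → List E → Finset V → Prop
  | single (v : V) : Arborescence G v [] {v}
  | join {v u : V} {e : E} {L₁ L₂ : List E} {W₁ W₂ : Finset V} : Arborescence G v L₁ W₁ →
      Arborescence G u L₂ W₂ → G.IsLink e v u → Disjoint W₁ W₂ →
      Arborescence G v (L₁ ++ e :: L₂) (W₁ ∪ W₂)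

lemma Arborescence.root_mem (h : Arborescence G v L W) : v ∈ W := by
  classical
  induction h with
  | single => simp
  | join _ _ _ _ ih _ => exact Finset.mem_union_left _ ih

lemma Arborescence.joined (h : Arborescence G v L W) : ∀ w ∈ W, Joined G {f | f ∈ L} v w := by
  classical
  induction h with
  | single =>
    intro w hw
    rw [Finset.mem_singleton.1 hw]
    exact .refl
  | @join v u e L₁ L₂ W₁ W₂ _ _ hl _ ih₁ ih₂ =>
    intro w hw
    rcases Finset.mem_union.1 hw with hw | hw
    · exact (ih₁ w hw).mono fun f hf => List.mem_append_left _ hf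
    · exact Joined.trans (.of_isLink (e := e) (by simp) hl)
        ((ih₂ w hw).mono fun f hf => List.mem_append_right _ (List.mem_cons_of_mem _ hf))

open Classical in
-- The new leaf is passed down to whichever half contains its neighbour. The edge list records the
-- order of the joins, so it is only determined up to permutation.
lemma Arborescence.exists_insert (h : Arborescence G v L W) (hl : G.IsLink e x y) (hx : x ∈ W)
    (hy : y ∉ W) : ∃ L', L'.Perm (e :: L) ∧ Arborescence G v L' (insert y W) := by
  induction h with
  | single w =>
    obtain rfl := Finset.mem_singleton.1 hx
    refine ⟨[] ++ e :: [], by simp, ?_⟩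
    have := Arborescence.join (.single x) (.single y) hl (by simpa using Ne.symm (by simpa using hy))
    rwa [Finset.union_comm, ← Finset.insert_eq] at this
  | @join v u f L₁ L₂ W₁ W₂ h₁ h₂ hl' hd ih₁ ih₂ =>
    rw [Finset.mem_union, not_or] at hy
    rcases Finset.mem_union.1 hx with hx | hx
    · obtain ⟨L', hp, h⟩ := ih₁ hx hy.1
      refine ⟨L' ++ f :: L₂, hp.append_right _, ?_⟩
      rw [← Finset.insert_union]
      exact .join h h₂ hl' (Finset.disjoint_insert_left.2 ⟨hy.2, hd⟩)
    · obtain ⟨L', hp, h⟩ := ih₂ hx hy.2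
      refine ⟨L₁ ++ f :: L', ?_, ?_⟩
      · refine ((hp.cons f).append_left L₁).trans ?_
        exact ((List.Perm.swap e f L₂).append_left L₁).trans List.perm_middle
      · rw [← Finset.union_insert]
        exact .join h₁ h hl' (Finset.disjoint_insert_right.2 ⟨hy.1, hd⟩)

/-- Growing leaf by leaf gives no control over the two sides of an edge; this passes to the
recursive form in which a tree can be split at an edge at its root. -/
lemma IsGrowth.exists_arborescence {r : V} (h : IsGrowth G r L) :
    ∃ L' W, L'.Perm L ∧ Arborescence G r L' W ∧
      ∀ v, v ∈ W ↔ v ∈ (edgeSpan G r {f | f ∈ L}).vertexSet := by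
  classical
  induction h with
  | nil => exact ⟨[], {r}, .refl _, .single r, fun v => by simp [mem_edgeSpan]⟩
  | @snoc L e x y h hl hx hy ih =>
    obtain ⟨L', W, hp, hA, hW⟩ := ih
    obtain ⟨L'', hp', hA'⟩ := hA.exists_insert hl ((hW x).2 hx) (fun h => hy ((hW y).1 h))
    refine ⟨L'', _, hp'.trans ((hp.cons e).trans (List.perm_append_singleton e L).symm), hA', ?_⟩
    intro v
    rw [Finset.mem_insert, hW, setOf_mem_append_singleton]
    constructor
    · rintro (rfl | hv)
      · exact Or.inr ⟨e, Set.mem_insert _ _, hl.inc_right⟩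
      · exact edgeSpan_vertexSet_mono (Set.subset_insert _ _) hv
    · rintro (hv | ⟨f, rfl | hf, hi⟩)
      · exact Or.inr (Or.inl hv)
      · rcases hi.eq_or_eq_of_isLink hl with rfl | rfl
        · exact Or.inr hx
        · exact Or.inl rfl
      · exact Or.inr (Or.inr ⟨f, hf, hi⟩)

/-- There is a connected set of edges from `A` of cost at most `M` that joins vertices whose prize is
at least `d` times the cost and at least `d * (M / 2)`. -/
def HasDensePart (G : Graph V E) (c : E → ℝ) (p : V → ℝ) (M d : ℝ) (A : Finset E) : Prop :=
  ∃ (F : Finset E) (U : Finset V) (v : V), F ⊆ A ∧ (∀ w ∈ U, Joined G F v w) ∧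
    ∑ e ∈ F, c e ≤ M ∧ d * ∑ e ∈ F, c e ≤ ∑ w ∈ U, p w ∧ d * (M / 2) ≤ ∑ w ∈ U, p w

variable {c : E → ℝ} {p : V → ℝ} {M d : ℝ} {A A' : Finset E}

lemma HasDensePart.mono (h : HasDensePart G c p M d A) (hA : A ⊆ A') :
    HasDensePart G c p M d A' := by
  obtain ⟨F, U, v, hF, h⟩ := h
  exact ⟨F, U, v, hF.trans hA, h⟩

lemma HasDensePart.of_le (hd : 0 ≤ d) {F : Finset E} {U : Finset V} {x : ℝ} (hF : F ⊆ A)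
    (hU : ∀ w ∈ U, Joined G F v w) (hx : ∑ e ∈ F, c e ≤ x) (hxM : x ≤ M)
    (h : d * x ≤ ∑ w ∈ U, p w) (h' : d * (M / 2) ≤ ∑ w ∈ U, p w) : HasDensePart G c p M d A :=
  ⟨F, U, v, hF, hU, hx.trans hxM, (mul_le_mul_of_nonneg_left hx hd).trans h, h'⟩

open Classical in
lemma sum_toFinset_le (hc : ∀ e, 0 ≤ c e) (L : List E) : ∑ e ∈ L.toFinset, c e ≤ (L.map c).sum := by
  induction L with
  | nil => simp
  | cons a L ih =>
    rw [List.toFinset_cons, List.map_cons, List.sum_cons]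
    by_cases h : a ∈ L.toFinset
    · rw [Finset.insert_eq_of_mem h]
      linarith [hc a]
    · rw [Finset.sum_insert h]
      linarith

lemma sum_union_le {ι : Type*} [DecidableEq ι] {f : ι → ℝ} (hf : ∀ i, 0 ≤ f i) (s t : Finset ι) :
    ∑ i ∈ s ∪ t, f i ≤ ∑ i ∈ s, f i + ∑ i ∈ t, f i := by
  rw [← Finset.sum_union_inter]
  exact le_add_of_nonneg_right (Finset.sum_nonneg fun i _ => hf i)

open Classical in
/-- A tree whose prize is at least `d` times its cost has a dense part. The tree may carry at its
root a lump of further edges `K` and vertices `U` of cost at most `b < M / 2`. -/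
lemma Arborescence.hasDensePart (hc : ∀ e, 0 ≤ c e) (hp : ∀ v, 0 ≤ p v) (hd : 0 ≤ d) (hM : 0 < M)
    (h : Arborescence G v L W) : ∀ (K : Finset E) (U : Finset V) (b : ℝ),
    (∀ w ∈ U, Joined G K v w) → Disjoint U W → ∑ e ∈ K, c e ≤ b → b < M / 2 →
    M / 2 ≤ b + (L.map c).sum → d * (b + (L.map c).sum) ≤ ∑ w ∈ U, p w + ∑ w ∈ W, p w →
    HasDensePart G c p M d (K ∪ L.toFinset) := by
  induction h with
  -- Here the total cost is just `b`, which cannot be both below and at least `M / 2`.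
  | single v =>
    intro K U b _ _ _ hb hb' _
    simp at hb'
    linarith
  | @join v u e L₁ L₂ W₁ W₂ h₁ h₂ hl hd₁₂ ih₁ ih₂ =>
    intro K U b hK hUW hKb hb hMb hdb
    rw [Finset.disjoint_union_right] at hUW
    obtain ⟨hU₁, hU₂⟩ := hUW
    have hsum : ((L₁ ++ e :: L₂).map c).sum = (L₁.map c).sum + c e + (L₂.map c).sum := by
      simp [add_assoc]
    rw [hsum] at hMb hdb
    rw [Finset.sum_union hd₁₂] at hdb
    have hj₁ : ∀ w ∈ W₁, Joined G (L₁.toFinset : Finset E) v w := fun w hw => by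
      simpa using h₁.joined w hw
    have hj₂ : ∀ w ∈ W₂, Joined G (L₂.toFinset : Finset E) u w := fun w hw => by
      simpa using h₂.joined w hw
    have hj₂' : ∀ w ∈ W₂, Joined G (insert e L₂.toFinset : Finset E) v w := fun w hw =>
      .trans (.of_isLink (by simp) hl) ((hj₂ w hw).mono (by simp))
    have hs₁ := sum_toFinset_le hc L₁
    have hs₂ := sum_toFinset_le hc L₂
    have hs₂' : ∑ f ∈ insert e L₂.toFinset, c f ≤ c e + (L₂.map c).sum := by
      simpa using sum_toFinset_le hc (e :: L₂)
    have hA : (L₁ ++ e :: L₂).toFinset = L₁.toFinset ∪ insert e L₂.toFinset := by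
      rw [List.toFinset_append, List.toFinset_cons]
    have sub₁ : L₁.toFinset ⊆ K ∪ (L₁ ++ e :: L₂).toFinset := by
      rw [hA]; intro f; simp; tauto
    have sub₂ : L₂.toFinset ⊆ K ∪ (L₁ ++ e :: L₂).toFinset := by
      rw [hA]; intro f; simp; tauto
    have sub₂' : insert e L₂.toFinset ⊆ K ∪ (L₁ ++ e :: L₂).toFinset := by
      rw [hA]; intro f; simp; tauto
    have subK : K ⊆ K ∪ (L₁ ++ e :: L₂).toFinset := Finset.subset_union_left
    have hjK₁ : ∀ w ∈ U ∪ W₁, Joined G (K ∪ L₁.toFinset : Finset E) v w := by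
      intro w hw
      rcases Finset.mem_union.1 hw with hw | hw
      · exact (hK w hw).mono (Finset.coe_subset.2 Finset.subset_union_left)
      · exact (hj₁ w hw).mono (Finset.coe_subset.2 Finset.subset_union_right)
    have hjK₂ : ∀ w ∈ U ∪ W₂, Joined G (K ∪ insert e L₂.toFinset : Finset E) v w := by
      intro w hw
      rcases Finset.mem_union.1 hw with hw | hw
      · exact (hK w hw).mono (Finset.coe_subset.2 Finset.subset_union_left)
      · exact (hj₂' w hw).mono (Finset.coe_subset.2 Finset.subset_union_right)
    have hj₁₂ : ∀ w ∈ W₁ ∪ W₂, Joined G (L₁.toFinset ∪ insert e L₂.toFinset : Finset E) v w := by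
      intro w hw
      rcases Finset.mem_union.1 hw with hw | hw
      · exact (hj₁ w hw).mono (Finset.coe_subset.2 Finset.subset_union_left)
      · exact (hj₂' w hw).mono (Finset.coe_subset.2 Finset.subset_union_right)
    have hsK₁ := (sum_union_le hc K L₁.toFinset).trans (add_le_add hKb hs₁)
    have hsK₂ := (sum_union_le hc K (insert e L₂.toFinset)).trans (add_le_add hKb hs₂')
    have hs₁₂ := (sum_union_le hc L₁.toFinset (insert e L₂.toFinset)).trans (add_le_add hs₁ hs₂')
    have hpU₁ := Finset.sum_union (f := p) hU₁
    have hpU₂ := Finset.sum_union (f := p) hU₂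
    have hp₁₂ := Finset.sum_union (f := p) hd₁₂
    have hce := hc e
    have hc₁ : 0 ≤ (L₁.map c).sum := (Finset.sum_nonneg fun f _ => hc f).trans hs₁
    have hc₂ : 0 ≤ (L₂.map c).sum := (Finset.sum_nonneg fun f _ => hc f).trans hs₂
    have hb0 : 0 ≤ b := (Finset.sum_nonneg fun f _ => hc f).trans hKb
    have hq : 0 ≤ ∑ w ∈ U, p w := Finset.sum_nonneg fun w _ => hp w
    have hq₁ : 0 ≤ ∑ w ∈ W₁, p w := Finset.sum_nonneg fun w _ => hp w
    have hq₂ : 0 ≤ ∑ w ∈ W₂, p w := Finset.sum_nonneg fun w _ => hp w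
    clear h₁ h₂ hsum
    have empty : ∀ x : V, ∀ w ∈ (∅ : Finset V), Joined G (∅ : Finset E) x w := by simp
    have IH₁ : M / 2 ≤ (L₁.map c).sum → d * (L₁.map c).sum ≤ ∑ w ∈ W₁, p w →
        HasDensePart G c p M d (K ∪ (L₁ ++ e :: L₂).toFinset) := fun h h' =>
      (ih₁ ∅ ∅ 0 (empty v) (by simp) (by simp) (by linarith) (by linarith) (by simpa using h')).mono
        (by simpa using sub₁)
    have IH₂ : M / 2 ≤ (L₂.map c).sum → d * (L₂.map c).sum ≤ ∑ w ∈ W₂, p w →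
        HasDensePart G c p M d (K ∪ (L₁ ++ e :: L₂).toFinset) := fun h h' =>
      (ih₂ ∅ ∅ 0 (empty u) (by simp) (by simp) (by linarith) (by linarith) (by simpa using h')).mono
        (by simpa using sub₂)
    have IHK₁ : M / 2 ≤ b + (L₁.map c).sum →
        d * (b + (L₁.map c).sum) ≤ ∑ w ∈ U, p w + ∑ w ∈ W₁, p w →
        HasDensePart G c p M d (K ∪ (L₁ ++ e :: L₂).toFinset) := fun h h' =>
      (ih₁ K U b hK hU₁ hKb hb h h').mono (Finset.union_subset subK sub₁)
    have mulM : ∀ {x : ℝ}, M / 2 ≤ x → d * (M / 2) ≤ d * x := fun h =>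
      mul_le_mul_of_nonneg_left h hd
    have key : d * (b + ((L₁.map c).sum + c e + (L₂.map c).sum)) =
        d * b + d * (L₁.map c).sum + d * c e + d * (L₂.map c).sum := by ring
    -- If everything costs at most `M`, take everything. Otherwise split at `e` into the lump, the
    -- side `W₁` at `v` and the side `W₂` at `u`.
    rcases le_or_gt (b + ((L₁.map c).sum + c e + (L₂.map c).sum)) M with hC | hC
    · have hU : Disjoint U (W₁ ∪ W₂) := Finset.disjoint_union_right.2 ⟨hU₁, hU₂⟩
      have hs := sum_union_le hc K (L₁.toFinset ∪ insert e L₂.toFinset)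
      refine .of_le (F := K ∪ (L₁.toFinset ∪ insert e L₂.toFinset)) (U := U ∪ (W₁ ∪ W₂)) (v := v)
        (x := b + ((L₁.map c).sum + c e + (L₂.map c).sum)) hd (by rw [hA]) ?_
        (by linarith) hC ?_ ?_
      · intro w hw
        rcases Finset.mem_union.1 hw with hw | hw
        · exact (hK w hw).mono (Finset.coe_subset.2 Finset.subset_union_left)
        · exact (hj₁₂ w hw).mono (Finset.coe_subset.2 Finset.subset_union_right)
      · rw [Finset.sum_union hU]; linarith
      · rw [Finset.sum_union hU]; linarith [mulM hMb]
    have BS₁ : b + (L₁.map c).sum < M / 2 → d * (M / 2) ≤ ∑ w ∈ U, p w + ∑ w ∈ W₁, p w →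
        HasDensePart G c p M d (K ∪ (L₁ ++ e :: L₂).toFinset) := fun h h' =>
      .of_le hd (Finset.union_subset subK sub₁) hjK₁ hsK₁ (by linarith)
        (by rw [hpU₁]; linarith [mul_le_mul_of_nonneg_left h.le hd]) (by rw [hpU₁]; exact h')
    rcases le_or_gt (M / 2) (L₂.map c).sum with h2 | h2
    -- The far side costs at least `M / 2`. If it has density `d`, recurse into it; if not, the rest
    -- has enough prize to pay for itself and for `e`.
    · by_cases hp2 : d * (L₂.map c).sum ≤ ∑ w ∈ W₂, p w
      · exact IH₂ h2 hp2
      push Not at hp2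
      rcases le_or_gt (M / 2) (b + (L₁.map c).sum) with h1 | h1
      · exact IHK₁ h1 (by linarith [mul_nonneg hd hce])
      rcases le_or_gt (M / 2) (b + (L₁.map c).sum + c e) with h3 | h3
      · exact BS₁ h1 (by linarith [mulM h3])
      -- The near side, the old lump and `e` together are still cheap, so they become the new lump
      -- at `u`.
      · refine (ih₂ (insert e (K ∪ L₁.toFinset)) (U ∪ W₁) (b + (L₁.map c).sum + c e) ?_
          (Finset.disjoint_union_left.2 ⟨hU₂, hd₁₂⟩) ?_ h3 ?_ ?_).mono ?_
        · intro w hw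
          exact .trans (.of_isLink (by simp) hl.symm)
            ((hjK₁ w hw).mono (Finset.coe_subset.2 (Finset.subset_insert _ _)))
        · have := sum_union_le hc {e} (K ∪ L₁.toFinset)
          rw [← Finset.insert_eq, Finset.sum_singleton] at this
          linarith
        · linarith
        · rw [hpU₁]; linarith
        · rw [hA]; intro f; simp
    · by_cases hp2 : d * (M / 2) ≤ ∑ w ∈ W₂, p w
      · exact .of_le hd sub₂ hj₂ hs₂ (by linarith)
          (by linarith [mul_le_mul_of_nonneg_left h2.le hd]) hp2
      push Not at hp2
      -- Now `W₂` has prize below `d * (M / 2)`. If it costs at least `M / 2` with `e`, dropping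
      -- both keeps the density, and as the total exceeds `M` the rest has prize at least `d * (M /
      -- 2)`.
      rcases le_or_gt (M / 2) (c e + (L₂.map c).sum) with h3 | h3
      · have h3' := mulM h3
        rcases le_or_gt (M / 2) (b + (L₁.map c).sum) with h1 | h1
        · exact IHK₁ h1 (by linarith)
        · exact BS₁ h1 (by linarith [mul_le_mul_of_nonneg_left hC.le hd])
      have P₂ : d * (b + (c e + (L₂.map c).sum)) ≤ ∑ w ∈ U, p w + ∑ w ∈ W₂, p w →
          M / 2 ≤ b + (c e + (L₂.map c).sum) →
          HasDensePart G c p M d (K ∪ (L₁ ++ e :: L₂).toFinset) := fun h h' =>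
        .of_le hd (Finset.union_subset subK sub₂') hjK₂ hsK₂ (by linarith) (by rwa [hpU₂])
          (by rw [hpU₂]; linarith [mulM h'])
      rcases le_or_gt (M / 2) (L₁.map c).sum with h1 | h1
      · rcases le_or_gt (M / 2) (b + (c e + (L₂.map c).sum)) with h4 | h4
        · by_cases hp4 : d * (b + (c e + (L₂.map c).sum)) ≤ ∑ w ∈ U, p w + ∑ w ∈ W₂, p w
          · exact P₂ hp4 h4
          · exact IH₁ h1 (by linarith)
        -- Here `W₂`, hung at `v` through `e`, is absorbed into the lump.
        · refine (ih₁ (K ∪ insert e L₂.toFinset) (U ∪ W₂) _ hjK₂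
            (Finset.disjoint_union_left.2 ⟨hU₁, hd₁₂.symm⟩) hsK₂ h4 (by linarith) ?_).mono ?_
          · rw [hpU₂]; linarith
          · exact Finset.union_subset (Finset.union_subset subK sub₂') sub₁
      -- Three pieces at `v` remain, each below `M / 2` and together above `M`, so any two cost
      -- between `M / 2` and `M`. If both pairs containing the lump have density below `d`, then so
      -- does the lump, and the remaining pair is dense enough.
      · by_cases hpa : d * (b + (c e + (L₂.map c).sum)) ≤ ∑ w ∈ U, p w + ∑ w ∈ W₂, p w
        · exact P₂ hpa (by linarith)
        by_cases hpb : d * (b + (L₁.map c).sum) ≤ ∑ w ∈ U, p w + ∑ w ∈ W₁, p w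
        · refine .of_le hd (Finset.union_subset subK sub₁) hjK₁ hsK₁ (by linarith) (by rwa [hpU₁]) ?_
          rw [hpU₁]
          linarith [mulM (show M / 2 ≤ b + (L₁.map c).sum by linarith)]
        · have : d * ((L₁.map c).sum + (c e + (L₂.map c).sum)) ≤ ∑ w ∈ W₁, p w + ∑ w ∈ W₂, p w := by
            linarith
          refine .of_le hd (Finset.union_subset sub₁ sub₂') hj₁₂ hs₁₂ (by linarith) (by rwa [hp₁₂]) ?_
          rw [hp₁₂]
          linarith [mulM (show M / 2 ≤ (L₁.map c).sum + (c e + (L₂.map c).sum) by linarith)]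

/-- One extraction step: a first part of cost `x` and prize `p₁`, then the fraction `l` of the ideal
from what is left. The bound is smallest for `p₁ = P * y / D`, where it becomes `P * (y + l * (M -
y))` up to the comparison `h8`; as `l ≤ 1` and `y ≥ M / 2`, this is at least `(1 + l) / 2 * M * P`.
-/
lemma greedy_bound {D M P p₁ p₂ q x y l : ℝ} (hl0 : 0 ≤ l) (hl1 : l ≤ 1) (hxy : x ≤ y)
    (hyM : M / 2 ≤ y) (hxM : x ≤ M) (hMD : M ≤ D) (hM : 0 < M) (hP : 0 ≤ P)
    (hp₂ : 0 ≤ p₂) (h₁ : P * y ≤ D * p₁) (h₂ : l * (M - x) * q ≤ (D - x) * p₂)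
    (hq : P - p₁ ≤ q) : (1 + l) / 2 * M * P ≤ D * (p₁ + p₂) := by
  rcases le_or_gt P p₁ with hPp | hPp
  · have h3 : (1 + l) / 2 * M * P ≤ D * P := by
      refine mul_le_mul_of_nonneg_right ?_ hP
      nlinarith
    have h4 : D * P ≤ D * (p₁ + p₂) := mul_le_mul_of_nonneg_left (by linarith) (by linarith)
    linarith
  · have hxD : 0 < D - x := by
      rcases (hxM.trans hMD).lt_or_eq with h | h
      · linarith
      · have hD : 0 < D := hM.trans_le hMD
        have : P * D ≤ P * y := mul_le_mul_of_nonneg_left (h ▸ hxy) hP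
        have : D * P ≤ D * p₁ := by linarith
        linarith [le_of_mul_le_mul_left this hD]
    have hx : 0 ≤ M - x := by linarith
    have h5 : l * (M - x) * (P - p₁) ≤ (D - x) * p₂ :=
      (mul_le_mul_of_nonneg_left hq (mul_nonneg hl0 hx)).trans h₂
    have h6 : 0 ≤ (D - x) - l * (M - x) := by nlinarith
    have h7 : P * y * ((D - x) - l * (M - x)) ≤ D * p₁ * ((D - x) - l * (M - x)) :=
      mul_le_mul_of_nonneg_right h₁ h6
    have h8 : (M - y) * (D - x) ≤ (M - x) * (D - y) := by
      nlinarith [mul_nonneg (sub_nonneg.2 hxy) (sub_nonneg.2 hMD)]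
    have h9 : P * l * ((M - y) * (D - x)) ≤ P * l * ((M - x) * (D - y)) :=
      mul_le_mul_of_nonneg_left h8 (mul_nonneg hP hl0)
    have h10 : P * (D - x) * ((1 + l) / 2 * M) ≤ P * (D - x) * (y + l * (M - y)) := by
      refine mul_le_mul_of_nonneg_left ?_ (mul_nonneg hP hxD.le)
      nlinarith
    have h11 : D * (l * (M - x) * (P - p₁)) ≤ D * ((D - x) * p₂) :=
      mul_le_mul_of_nonneg_left h5 (by linarith)
    refine le_of_mul_le_mul_left ?_ hxD
    linarith

open Classical in
/-- In a tree of cost at most `D`, up to `ℓ` connected parts of total cost at most `M` suffice to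
collect the fraction `(1 - 2⁻ˡ) * M / D` of the prize. -/
lemma Arborescence.exists_parts (h : Arborescence G v L W) (ℓ : ℕ) : ∀ {c : E → ℝ} {p : V → ℝ}
    {M D : ℝ}, (∀ e, 0 ≤ c e) → (∀ v, 0 ≤ p v) → (L.map c).sum ≤ D → 0 ≤ M → M ≤ D →
    ∃ (F : Finset E) (U S : Finset V), F ⊆ L.toFinset ∧ S.card ≤ ℓ ∧
      (∀ w ∈ U, ∃ v ∈ S, Joined G F v w) ∧
      ∑ e ∈ F, c e ≤ M ∧ (1 - (1 / 2) ^ ℓ) * M * ∑ w ∈ W, p w ≤ D * ∑ w ∈ U, p w := by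
  induction ℓ with
  | zero =>
    intro c p M D _ _ _ hM _
    exact ⟨∅, ∅, ∅, by simp, by simp, by simp, by simpa using hM, by simp⟩
  | succ ℓ ih =>
    intro c p M D hc hp hLD hM hMD
    have hP : 0 ≤ ∑ w ∈ W, p w := Finset.sum_nonneg fun w _ => hp w
    have hpow0 : (0 : ℝ) ≤ (1 / 2) ^ ℓ := by positivity
    have hpow1 : ((1 : ℝ) / 2) ^ ℓ ≤ 1 := pow_le_one₀ (by norm_num) (by norm_num)
    rcases hM.eq_or_lt with rfl | hM
    · exact ⟨∅, ∅, ∅, by simp, by simp, by simp, by simp, by simp⟩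
    have hD : 0 < D := hM.trans_le hMD
    rcases lt_or_ge (L.map c).sum (M / 2) with hL | hL
    -- A tree cheaper than `M / 2` is itself a single admissible part.
    · refine ⟨L.toFinset, W, {v}, subset_rfl, by simp, fun w hw => ⟨v, by simp, ?_⟩, ?_, ?_⟩
      · simpa using h.joined w hw
      · linarith [sum_toFinset_le hc L]
      · refine mul_le_mul_of_nonneg_right ?_ hP
        rw [pow_succ]
        nlinarith
    set P := ∑ w ∈ W, p w with hPdef
    -- The density threshold is `P / D`, a lower bound for the density of the whole tree.
    obtain ⟨F₁, U₁, v₁, hF₁, hj₁, hc₁, hd₁, hd₁'⟩ := h.hasDensePart hc hp (d := P / D)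
      (div_nonneg hP hD.le) hM ∅ ∅ 0 (by simp) (by simp) (by simp) (by linarith) (by linarith) (by
        rw [zero_add, Finset.sum_empty, zero_add, ← hPdef, div_mul_eq_mul_div, div_le_iff₀ hD]
        exact mul_le_mul_of_nonneg_left hLD hP)
    rw [Finset.empty_union] at hF₁
    set x := ∑ e ∈ F₁, c e with hx
    rw [div_mul_eq_mul_div, div_le_iff₀ hD] at hd₁ hd₁'
    have hsplit : (L.map c).sum = (L.map fun e => if e ∈ F₁ then 0 else c e).sum +
        (L.map fun e => if e ∈ F₁ then c e else 0).sum := by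
      rw [← List.sum_map_add]
      congr 1
      refine List.map_congr_left fun e _ => ?_
      split_ifs <;> simp
    have hx' : x ≤ (L.map fun e => if e ∈ F₁ then c e else 0).sum := by
      refine le_trans ?_ (sum_toFinset_le (fun e => ?_) L)
      · rw [Finset.sum_ite_mem, Finset.inter_eq_right.2 hF₁]
      · split_ifs
        exacts [hc e, le_rfl]
    -- The tree itself is kept, but edges and vertices already taken get cost and prize `0`. Later
    -- parts may thus run through earlier ones for free and stay connected.
    obtain ⟨F₂, U₂, S₂, hF₂, hS₂, hj₂, hc₂, hp₂⟩ := ih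
      (c := fun e => if e ∈ F₁ then 0 else c e) (p := fun w => if w ∈ U₁ then 0 else p w)
      (M := M - x) (D := D - x) (fun e => by split_ifs; exacts [le_rfl, hc e])
      (fun w => by split_ifs; exacts [le_rfl, hp w])
      (by linarith) (by linarith) (by linarith)
    have hcF : ∑ e ∈ F₁ ∪ F₂, c e = x + ∑ e ∈ F₂ \ F₁, c e := by
      rw [← Finset.union_sdiff_self_eq_union, Finset.sum_union Finset.disjoint_sdiff]
    have hpU : ∑ w ∈ U₁ ∪ U₂, p w = ∑ w ∈ U₁, p w + ∑ w ∈ U₂ \ U₁, p w := by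
      rw [← Finset.union_sdiff_self_eq_union, Finset.sum_union Finset.disjoint_sdiff]
    have hc₂' : ∑ e ∈ F₂ \ F₁, c e ≤ M - x := by
      rw [← Finset.filter_notMem_eq_sdiff, Finset.sum_filter]
      refine le_of_eq_of_le (Finset.sum_congr rfl fun i _ => ?_) hc₂
      by_cases hi : i ∈ F₁ <;> simp [hi]
    have hpd : ∀ t : Finset V, ∑ i ∈ t, (if i ∈ U₁ then 0 else p i) = ∑ i ∈ t \ U₁, p i := by
      intro t
      rw [← Finset.filter_notMem_eq_sdiff, Finset.sum_filter]
      refine Finset.sum_congr rfl fun i _ => ?_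
      by_cases hi : i ∈ U₁ <;> simp [hi]
    rw [hpd, hpd] at hp₂
    refine ⟨F₁ ∪ F₂, U₁ ∪ U₂, insert v₁ S₂, Finset.union_subset hF₁ hF₂,
      (Finset.card_insert_le _ _).trans (by omega), ?_, by linarith, ?_⟩
    · intro w hw
      rcases Finset.mem_union.1 hw with hw | hw
      · exact ⟨v₁, by simp, (hj₁ w hw).mono (Finset.coe_subset.2 Finset.subset_union_left)⟩
      · obtain ⟨v, hv, hj⟩ := hj₂ w hw
        exact ⟨v, by simp [hv], hj.mono (Finset.coe_subset.2 Finset.subset_union_right)⟩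
    · have hq : P - ∑ w ∈ U₁, p w ≤ ∑ w ∈ W \ U₁, p w := by
        have h1 := Finset.sum_inter_add_sum_sdiff W U₁ p
        have h2 : ∑ w ∈ W ∩ U₁, p w ≤ ∑ w ∈ U₁, p w :=
          Finset.sum_le_sum_of_subset_of_nonneg Finset.inter_subset_right fun w _ _ => hp w
        linarith
      -- The two guarantees for the first part, prize at least `d * x` and at least `d * (M / 2)`,
      -- merge into one with `y = max x (M / 2)`.
      have hg := greedy_bound (y := max x (M / 2)) (sub_nonneg.2 hpow1) (by linarith)
        (le_max_left _ _) (le_max_right _ _) hc₁ hMD hM hP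
        (Finset.sum_nonneg fun w _ => hp w) (?_) hp₂ hq
      · rw [hpU]
        refine le_of_eq_of_le ?_ hg
        rw [pow_succ]
        ring
      · rcases max_choice x (M / 2) with h | h <;> rw [h] <;> linarith

end Decomposition

/-! ### Prizes and costs as finite sums, and halting runs. -/

section Totals

variable {V E : Type*} {G H T : Graph V E} {r v : V} {c : E → ℝ} {p : V → ℝ} {L : List E}

lemma totalPrize_eq_sum [Finite V] (p : V → ℝ) (H : Graph V E) :
    totalPrize p H = ∑ v ∈ H.vertexSet.toFinite.toFinset, p v :=
  finsum_mem_eq_finite_toFinset_sum _ _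

lemma totalCost_eq_sum [Finite E] (c : E → ℝ) (H : Graph V E) :
    totalCost c H = ∑ e ∈ H.edgeSet.toFinite.toFinset, c e :=
  finsum_mem_eq_finite_toFinset_sum _ _

lemma totalPrize_congr {T : Graph V E} (h : H.vertexSet = T.vertexSet) :
    totalPrize p H = totalPrize p T := by
  rw [totalPrize, totalPrize, h]

lemma sum_le_totalPrize [Finite V] (hp : ∀ v ∈ H.vertexSet, 0 ≤ p v) {U : Finset V}
    (hU : ∀ v ∈ U, 0 < p v → v ∈ H.vertexSet) : ∑ v ∈ U, p v ≤ totalPrize p H := by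
  classical
  rw [totalPrize_eq_sum, ← Finset.sum_filter_add_sum_filter_not U (fun v => 0 < p v)]
  have h1 : ∑ v ∈ U with ¬ 0 < p v, p v ≤ 0 :=
    Finset.sum_nonpos fun v hv => not_lt.1 (Finset.mem_filter.1 hv).2
  have h2 : ∑ v ∈ U with 0 < p v, p v ≤ ∑ v ∈ H.vertexSet.toFinite.toFinset, p v := by
    refine Finset.sum_le_sum_of_subset_of_nonneg (fun v hv => ?_) fun v hv _ => hp v (by simpa using hv)
    rw [Finset.mem_filter] at hv
    simpa using hU v hv.1 hv.2
  linarith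

lemma totalPrize_le [Finite V] (hp : ∀ v ∈ H.vertexSet, 0 ≤ p v)
    (h : ∀ v ∈ T.vertexSet, 0 < p v → v ∈ H.vertexSet) : totalPrize p T ≤ totalPrize p H := by
  rw [totalPrize_eq_sum p T]
  exact sum_le_totalPrize hp fun v hv => h v (by simpa using hv)

lemma totalPrize_nonneg (hp : ∀ v ∈ H.vertexSet, 0 ≤ p v) : 0 ≤ totalPrize p H :=
  finsum_nonneg fun v => finsum_nonneg fun hv => hp v hv

lemma le_totalPrize [Finite V] (hp : ∀ v ∈ H.vertexSet, 0 ≤ p v) (hv : v ∈ H.vertexSet) :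
    p v ≤ totalPrize p H := by
  simpa using sum_le_totalPrize hp (U := {v}) (by simpa using fun _ => hv)

lemma list_sum_le_totalCost [Finite E] (hc : ∀ e ∈ H.edgeSet, 0 ≤ c e) (hL : L.Nodup)
    (hLH : ∀ e ∈ L, e ∈ H.edgeSet) : (L.map c).sum ≤ totalCost c H := by
  classical
  rw [totalCost_eq_sum, ← List.sum_toFinset _ hL]
  refine Finset.sum_le_sum_of_subset_of_nonneg (fun e he => ?_) fun e he _ => hc e (by simpa using he)
  simpa using hLH e (by simpa using he)

lemma totalCost_edgeSpan_list (hL : L.Nodup) (hLG : ∀ e ∈ L, e ∈ G.edgeSet) :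
    totalCost c (edgeSpan G r {e | e ∈ L}) = (L.map c).sum := by
  classical
  rw [totalCost, edgeSet_edgeSpan (show {e | e ∈ L} ⊆ G.edgeSet from hLG), ← List.sum_toFinset _ hL]
  have : {e | e ∈ L} = (L.toFinset : Set E) := by ext; simp
  rw [this, finsum_mem_coe_finset]

instance [Finite V] [Finite E] : Finite (Graph V E) := by
  refine Finite.of_injective
    (fun G : Graph V E => (G.vertexSet, G.IsLink) : Graph V E → Set V × (E → V → V → Prop)) ?_
  intro G H h
  simp only [Prod.mk.injEq] at h
  exact Graph.ext h.1 fun e x y => by rw [h.2]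

lemma AlwaysHalts.exists_halt {σ : Type*} {step : σ → σ → Prop} {halt : σ → Prop} {s₀ : σ}
    (h : AlwaysHalts step halt s₀) : ∃ s, ReflTransGen step s₀ s ∧ halt s := by
  by_contra! hno
  have hstep : ∀ s : {s // ReflTransGen step s₀ s}, ∃ s' : {s // ReflTransGen step s₀ s},
      step s s' := by
    rintro ⟨s, hs⟩
    rcases h.2 s hs with h' | ⟨s', h'⟩
    · exact (hno s hs h').elim
    · exact ⟨⟨s', hs.tail h'⟩, h'⟩
  choose next hnext using hstep
  exact h.1 ⟨fun n => (Nat.rec ⟨s₀, .refl⟩ (fun _ => next) n : {s // ReflTransGen step s₀ s}),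
    rfl, fun n => hnext _⟩

end Totals

/-! ### The density-greedy algorithm: growth, coverage, termination. -/

section Greedy

variable {V E : Type*} {T : Graph V E} {r : V} {c : E → ℝ} {p : V → ℝ} {π π' : List E} {e : E}
  {a b v : V}

open Classical in
/-- The contraction map of the residual graph. -/
def collapse (T : Graph V E) (r : V) (π : List E) (v : V) : V :=
  if v ∈ (edgeSpan T r {e | e ∈ π}).vertexSet then r else v

lemma collapse_of_mem (h : v ∈ (edgeSpan T r {e | e ∈ π}).vertexSet) : collapse T r π v = r :=
  if_pos h

lemma collapse_of_notMem (h : v ∉ (edgeSpan T r {e | e ∈ π}).vertexSet) :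
    collapse T r π v = v :=
  if_neg h

lemma mem_residual : v ∈ (residual T r π).vertexSet ↔ ∃ w ∈ T.vertexSet, collapse T r π w = v := by
  simp [residual, contract, collapse]

lemma residual_isLink : (residual T r π).IsLink e a b ↔
    ∃ x y, T.IsLink e x y ∧ e ∉ π ∧ collapse T r π x = a ∧ collapse T r π y = b := by
  have : (residual T r π).IsLink e a b ↔ ∃ x y,
      (T.deleteEdges (edgeSpan T r {e | e ∈ π}).edgeSet).IsLink e x y ∧
        collapse T r π x = a ∧ collapse T r π y = b := Iff.rfl
  rw [this]
  refine exists_congr fun x => exists_congr fun y => ?_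
  rw [Graph.deleteEdges_isLink, and_assoc]
  refine and_congr_right fun hl => and_congr_left fun _ => not_congr ⟨fun h => ?_, fun h => ?_⟩
  · obtain ⟨_, _, h⟩ := Graph.exists_isLink_of_mem_edgeSet h
    exact h.2
  · exact Graph.IsLink.edge_mem (G := edgeSpan T r {e | e ∈ π}) ⟨hl, h⟩

lemma residual_joined (h : Joined T T.edgeSet r v) :
    Joined (residual T r π) (residual T r π).edgeSet r (collapse T r π v) := by
  induction h with
  | refl =>
    rw [collapse_of_mem (Or.inl rfl)]
    exact .refl
  | @tail x y _ h ih =>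
    obtain ⟨e, -, hl⟩ := h
    by_cases he : e ∈ π
    · rw [collapse_of_mem (Or.inr ⟨e, he, hl.inc_right⟩)]
      exact .refl
    · have := (residual_isLink (r := r)).2 ⟨x, y, hl, he, rfl, rfl⟩
      exact ih.trans (.of_isLink this.edge_mem this)

lemma contractPrize_nonneg (hp : ∀ v ∈ T.vertexSet, 0 ≤ p v) :
    ∀ v ∈ (residual T r π).vertexSet, 0 ≤ contractPrize p r v := by
  intro v hv
  obtain ⟨w, hw, rfl⟩ := mem_residual.1 hv
  unfold contractPrize
  split_ifs with h
  · exact le_rfl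
  · unfold collapse at h ⊢
    split_ifs at h ⊢ with h'
    · exact (h rfl).elim
    · exact hp w hw

lemma GreedyHalt.mem_edgeSpan [Finite V] (hp : ∀ v ∈ T.vertexSet, 0 ≤ p v)
    (h : GreedyHalt T p r π) (hv : v ∈ T.vertexSet) (hpv : 0 < p v) :
    v ∈ (edgeSpan T r {e | e ∈ π}).vertexSet := by
  by_contra hcon
  have hvr : v ≠ r := fun h => hcon (Or.inl h)
  have h1 := le_totalPrize (contractPrize_nonneg (r := r) (π := π) hp)
    (mem_residual.2 ⟨v, hv, collapse_of_notMem hcon⟩)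
  rw [h, contractPrize, if_neg hvr] at h1
  linarith

/-- An edge of a tree at `r` is no loop, so in the original tree it leads from the contracted part
to a vertex outside it. -/
lemma GreedyStep.isGrowth (h : GreedyStep T c p r π π') (hπ : IsGrowth T r π) :
    IsGrowth T r π' ∧ π'.length = π.length + 1 := by
  obtain ⟨-, S, e, hS, ⟨b, hb⟩, rfl⟩ := h
  obtain ⟨hle, ⟨-, hac⟩, -⟩ := hS.prop.1
  have hbr : b ≠ r := by
    rintro rfl
    exact hac e b b hb .refl
  obtain ⟨x, y, hl, -, hx, rfl⟩ := residual_isLink.1 (hb.mono hle)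
  refine ⟨.snoc hπ hl ?_ fun hy => hbr (collapse_of_mem hy), by simp⟩
  by_contra hx'
  rw [collapse_of_notMem hx'] at hx
  exact hx' (Or.inl hx)

lemma GreedyOutput.isGrowth (h : GreedyOutput T c p r π) (hr : r ∈ T.vertexSet) :
    IsGrowth T r π := by
  obtain ⟨h, -⟩ := h
  induction h with
  | refl => exact .nil hr
  | tail _ h ih => exact (h.isGrowth ih).1

/-- A spanning tree of the residual graph has positive density. A min-max subtree therefore carries
prize away from the root, and so has an edge at the root to append. -/
lemma exists_greedyStep [Finite V] [Finite E] (hT : IsConnected T) (hr : r ∈ T.vertexSet)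
    (hc : ∀ e ∈ T.edgeSet, 0 < c e) (hp : ∀ v ∈ T.vertexSet, 0 ≤ p v)
    (h : ¬ GreedyHalt T p r π) : ∃ π', GreedyStep T c p r π π' := by
  classical
  set R := residual T r π with hR
  have hrR : r ∈ R.vertexSet := mem_residual.2 ⟨r, hr, collapse_of_mem (Or.inl rfl)⟩
  have hpR := contractPrize_nonneg (r := r) (π := π) hp
  obtain ⟨L, hL, -, hspan⟩ := exists_isGrowth hrR R.edgeSet
  have hV : (edgeSpan R r {f | f ∈ L}).vertexSet = R.vertexSet := by
    refine Set.Subset.antisymm hL.isRootedSubtree.1.1 fun v hv => hspan v ?_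
    obtain ⟨w, hw, rfl⟩ := mem_residual.1 hv
    exact residual_joined (joined_edgeSet.1 (hT.2 r hr w hw))
  have hpos : 0 < totalPrize (contractPrize p r) (edgeSpan R r {f | f ∈ L}) := by
    rw [totalPrize_congr hV]
    exact lt_of_le_of_ne (totalPrize_nonneg hpR) (Ne.symm h)
  have hcR : ∀ e ∈ R.edgeSet, 0 < c e := by
    intro e he
    obtain ⟨x, y, he⟩ := Graph.exists_isLink_of_mem_edgeSet he
    obtain ⟨x, y, hl, -⟩ := residual_isLink.1 he
    exact hc e hl.edge_mem
  have hdens : 0 < density c (contractPrize p r) (edgeSpan R r {f | f ∈ L}) := by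
    refine div_pos hpos ?_
    rw [totalCost_edgeSpan_list hL.nodup hL.subset]
    refine List.sum_pos _ (by simpa using fun e he => hcR e (hL.subset e he)) ?_
    rintro hnil
    rw [List.map_eq_nil_iff] at hnil
    subst hnil
    have : (edgeSpan R r {f | f ∈ ([] : List E)}).vertexSet = {r} := by
      ext v
      simp [mem_edgeSpan]
    rw [totalPrize, this, finsum_mem_singleton, contractPrize, if_pos rfl] at hpos
    exact lt_irrefl _ hpos
  have hmax : {S | IsMaxDensity R c (contractPrize p r) r S}.Nonempty := by
    obtain ⟨S, hS, hS'⟩ := Set.exists_max_image {S | IsRootedSubtree R r S}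
      (density c (contractPrize p r)) (Set.toFinite _) ⟨_, hL.isRootedSubtree⟩
    exact ⟨S, hS, hS'⟩
  obtain ⟨S, hS⟩ := (Set.toFinite {S | IsMaxDensity R c (contractPrize p r) r S}).exists_minimal hmax
  have hS0 : totalPrize (contractPrize p r) S ≠ 0 := by
    intro h0
    have := hS.prop.2 _ hL.isRootedSubtree
    rw [density, density, h0, zero_div] at this
    exact absurd hdens (not_lt.2 this)
  obtain ⟨v, hv, hv0⟩ := exists_ne_zero_of_finsum_mem_ne_zero hS0
  have hvr : v ≠ r := by
    rintro rfl
    exact hv0 (if_pos rfl)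
  obtain ⟨-, hStree, hrS⟩ := hS.prop.1
  rcases (hStree.1.2 r hrS v hv).cases_head with h' | ⟨b, ⟨e, hb⟩, -⟩
  · exact (hvr h'.symm).elim
  · exact ⟨π ++ [e], h, S, e, hS, ⟨b, hb⟩, rfl⟩

lemma alwaysHalts_greedy [Finite V] [Finite E] (hT : IsConnected T) (hr : r ∈ T.vertexSet)
    (hc : ∀ e ∈ T.edgeSet, 0 < c e) (hp : ∀ v ∈ T.vertexSet, 0 ≤ p v) :
    AlwaysHalts (GreedyStep T c p r) (GreedyHalt T p r) [] := by
  constructor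
  · rintro ⟨s, h0, hs⟩
    have := Fintype.ofFinite E
    have key : ∀ n, IsGrowth T r (s n) ∧ (s n).length = n := by
      intro n
      induction n with
      | zero => rw [h0]; exact ⟨.nil hr, rfl⟩
      | succ n ih =>
        obtain ⟨h1, h2⟩ := (hs n).isGrowth ih.1
        exact ⟨h1, by rw [h2, ih.2]⟩
    have h1 := (key (Fintype.card E + 1)).1.nodup.length_le_card
    rw [(key _).2] at h1
    omega
  · intro π _
    by_cases h : GreedyHalt T p r π
    · exact Or.inl h
    · exact Or.inr (exists_greedyStep hT hr hc hp h)

end Greedy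

/-! ### Walks and paths, needed for distances from the root. -/

section Walks

variable {V E : Type*} {G : Graph V E} {r x y z : V} {w : List (E × V)} {e : E} {L : List E}

lemma IsWalk.snoc (h : IsWalk G x w y) (hl : G.IsLink e y z) : IsWalk G x (w ++ [(e, z)]) z := by
  induction h with
  | nil => exact .cons hl (.nil hl.right_mem)
  | cons h _ ih => exact .cons h (ih hl)

lemma IsWalk.joined (h : IsWalk G x w y) : Joined G {e | e ∈ w.map Prod.fst} x y := by
  induction h with
  | nil => exact .refl
  | cons h _ ih =>
    exact .trans (.of_isLink (by simp) h) (ih.mono fun f hf => by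
      rw [List.map_cons]
      exact List.mem_cons_of_mem _ hf)

lemma IsWalk.mem_edgeSet (h : IsWalk G x w y) : ∀ e ∈ w.map Prod.fst, e ∈ G.edgeSet := by
  induction h with
  | nil => simp
  | cons h _ ih =>
    rw [List.map_cons]
    intro f hf
    rcases List.mem_cons.1 hf with rfl | hf
    · exact h.edge_mem
    · exact ih f hf

lemma IsGrowth.exists_isPath (h : IsGrowth G r L) : ∀ v ∈ (edgeSpan G r {f | f ∈ L}).vertexSet,
    ∃ w, IsPath G r w v ∧ ∀ s ∈ w, s.2 ∈ (edgeSpan G r {f | f ∈ L}).vertexSet := by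
  induction h with
  | nil hr =>
    rintro v (rfl | ⟨e, he, -⟩)
    · exact ⟨[], ⟨.nil hr, by simp⟩, by simp⟩
    · simp at he
  | @snoc L e x y h hl hx hy ih =>
    have hsub : (edgeSpan G r {f | f ∈ L}).vertexSet ⊆
        (edgeSpan G r {f | f ∈ L ++ [e]}).vertexSet :=
      edgeSpan_vertexSet_mono fun f hf => List.mem_append_left _ hf
    have old : ∀ v ∈ (edgeSpan G r {f | f ∈ L}).vertexSet, ∃ w, IsPath G r w v ∧
        ∀ s ∈ w, s.2 ∈ (edgeSpan G r {f | f ∈ L ++ [e]}).vertexSet := by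
      intro v hv
      obtain ⟨w, hw, hw'⟩ := ih v hv
      exact ⟨w, hw, fun s hs => hsub (hw' s hs)⟩
    have hymem : y ∈ (edgeSpan G r {f | f ∈ L ++ [e]}).vertexSet :=
      Or.inr ⟨e, by simp, hl.inc_right⟩
    intro v hv
    by_cases hvL : v ∈ (edgeSpan G r {f | f ∈ L}).vertexSet
    · exact old v hvL
    obtain rfl : v = y := by
      rcases hv with rfl | ⟨f, hf, hi⟩
      · exact (hvL (Or.inl rfl)).elim
      · rcases List.mem_append.1 hf with hf | hf
        · exact (hvL (Or.inr ⟨f, hf, hi⟩)).elim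
        · rw [List.mem_singleton.1 hf] at hi
          rcases hi.eq_or_eq_of_isLink hl with rfl | rfl
          · exact (hvL hx).elim
          · rfl
    obtain ⟨w, ⟨hw, hnd⟩, hw'⟩ := ih x hx
    refine ⟨w ++ [(e, v)], ⟨hw.snoc hl, ?_⟩, ?_⟩
    · rw [List.map_append, ← List.cons_append, List.nodup_append]
      refine ⟨hnd, by simp, ?_⟩
      rintro a ha b hb rfl
      simp only [List.map_cons, List.map_nil, List.mem_singleton] at hb
      subst hb
      rcases List.mem_cons.1 ha with rfl | ha
      · exact hvL (Or.inl rfl)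
      · obtain ⟨s, hs, rfl⟩ := List.mem_map.1 ha
        exact hvL (hw' s hs)
    · intro s hs
      rcases List.mem_append.1 hs with hs | hs
      · exact hsub (hw' s hs)
      · rw [List.mem_singleton.1 hs]
        exact hymem

end Walks

/-! ### Invariants and termination of the capacity-scaling algorithm. -/

namespace Instance

variable {V E : Type*} {I : Instance V E} {B : ℝ} {v : V} {T : Graph V E} {L π π' ρ : List E}
  {i : ℕ}

lemma isRootedSubtree_pos (hT : IsRootedSubtree I.graph I.root T) : ∀ e ∈ T.edgeSet, 0 < I.cost e :=
  fun e he => I.cost_pos e (hT.1.edgeSet_mono he)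

lemma isRootedSubtree_nonneg (hT : IsRootedSubtree I.graph I.root T) :
    ∀ v ∈ T.vertexSet, 0 ≤ I.prize v :=
  fun v hv => I.prize_nonneg v (hT.1.1 hv)

lemma cost_list_nonneg (h : ∀ e ∈ L, e ∈ I.graph.edgeSet) : 0 ≤ (L.map I.cost).sum := by
  refine List.sum_nonneg ?_
  simpa using fun e he => (I.cost_pos e (h e he)).le

variable (I) in
/-- A growth that reaches every vertex of the graph. -/
lemma exists_spanning_isGrowth [Finite E] : ∃ L, IsGrowth I.graph I.root L ∧
    ∀ v ∈ I.graph.vertexSet, v ∈ (I.span L).vertexSet := by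
  obtain ⟨L, hL, -, h⟩ := exists_isGrowth I.root_mem I.graph.edgeSet
  exact ⟨L, hL, fun v hv => h v (joined_edgeSet.1 (I.connected.2 _ I.root_mem v hv))⟩

/-- Appending the edges of a growth one by one. -/
lemma foldl_appendEdge (hπ : IsGrowth I.graph I.root π) (hρ : IsGrowth I.graph I.root ρ) :
    IsGrowth I.graph I.root (ρ.foldl I.appendEdge π) ∧ π <+: ρ.foldl I.appendEdge π ∧
      (I.span ρ).vertexSet ⊆ (I.span (ρ.foldl I.appendEdge π)).vertexSet ∧
      ((ρ.foldl I.appendEdge π).map I.cost).sum ≤ (π.map I.cost).sum + (ρ.map I.cost).sum := by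
  induction hρ with
  | nil =>
    refine ⟨hπ, List.prefix_rfl, ?_, by simp⟩
    rintro v (h | ⟨e, he, -⟩)
    · exact Or.inl h
    · simp at he
  | @snoc ρ e x y hρ hl hx hy ih =>
    obtain ⟨ih1, ih2, ih3, ih4⟩ := ih
    rw [List.foldl_append, List.foldl_cons, List.foldl_nil]
    set σ := ρ.foldl I.appendEdge π
    have hce := I.cost_pos e hl.edge_mem
    have hxσ := ih3 hx
    have hspan : ∀ τ : List E, σ <+: τ → y ∈ (I.span τ).vertexSet →
        (I.span (ρ ++ [e])).vertexSet ⊆ (I.span τ).vertexSet := by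
      intro τ hτ hyτ
      have hsub : (I.span σ).vertexSet ⊆ (I.span τ).vertexSet :=
        edgeSpan_vertexSet_mono fun f hf => hτ.subset hf
      rintro v (rfl | ⟨f, hf, hi⟩)
      · exact Or.inl rfl
      · rcases List.mem_append.1 hf with hf | hf
        · exact hsub (ih3 (Or.inr ⟨f, hf, hi⟩))
        · rw [List.mem_singleton.1 hf] at hi
          rcases hi.eq_or_eq_of_isLink hl with rfl | rfl
          · exact hsub hxσ
          · exact hyτ
    rw [appendEdge]
    split_ifs with hcyc
    -- A skipped edge loses nothing: its near end is already spanned, and the cycle shows that its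
    -- far end is too.
    · obtain ⟨x', y', hl', hj⟩ := hcyc
      have hj := joined_edgeSpan.1 hj
      have hyσ : y ∈ (I.span σ).vertexSet := by
        obtain ⟨rfl, rfl⟩ | ⟨rfl, rfl⟩ := hl.eq_and_eq_or_eq_and_eq hl'
        · exact mem_edgeSpan_of_joined hxσ hj
        · exact mem_edgeSpan_of_joined hxσ hj.symm
      refine ⟨ih1, ih2, hspan σ List.prefix_rfl hyσ, ?_⟩
      rw [List.map_append, List.sum_append, List.map_singleton, List.sum_singleton]
      linarith
    · refine ⟨.snoc ih1 hl hxσ fun hyσ => hcyc ⟨x, y, hl, joined_edgeSpan.2 ?_⟩,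
        ih2.trans (List.prefix_append _ _),
        hspan _ (List.prefix_append _ _) (Or.inr ⟨e, by simp, hl.inc_right⟩), ?_⟩
      · exact ih1.isRootedSubtree.joined hxσ hyσ
      · simp only [List.map_append, List.sum_append, List.map_singleton, List.sum_singleton]
        linarith

variable (I) in
/-- The states reached by the capacity-scaling algorithm. -/
def IsGoodState (s : ℕ × List E) : Prop :=
  IsGrowth I.graph I.root s.2 ∧ (s.2.map I.cost).sum ≤ (2 ^ s.1 - 1) * I.eccentricity ∧
    ∀ j < s.1, ∃ π T, π <+: s.2 ∧ (π.map I.cost).sum ≤ (2 ^ (j + 1) - 1) * I.eccentricity ∧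
      I.IsOpt (2 ^ j * I.eccentricity) T ∧
      ∀ v ∈ T.vertexSet, 0 < I.prize v → v ∈ (I.span π).vertexSet

lemma isGoodState_zero : I.IsGoodState (0, []) :=
  ⟨.nil I.root_mem, by simp, by simp⟩

lemma alg_vertexSet_subset : (I.alg π B).vertexSet ⊆ I.graph.vertexSet := by
  rintro v (rfl | ⟨e, -, hi⟩)
  · exact I.root_mem
  · exact hi.vertex_mem

lemma span_subset_alg (hπ : ∀ e ∈ π, e ∈ I.graph.edgeSet) (h : π' <+: π)
    (hB : (π'.map I.cost).sum ≤ B) : (I.span π').vertexSet ⊆ (I.alg π B).vertexSet := by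
  refine edgeSpan_vertexSet_mono fun e he => ?_
  obtain ⟨i, hi, rfl⟩ := List.getElem_of_mem he
  obtain ⟨τ, rfl⟩ := h
  refine ⟨i, ?_, ?_⟩
  · rw [List.getElem?_append_left hi, List.getElem?_eq_getElem hi]
  · rw [List.take_append_of_le_length hi]
    refine le_trans ?_ hB
    conv_rhs => rw [← List.take_append_drop (i + 1) π', List.map_append, List.sum_append]
    have := cost_list_nonneg (I := I) (L := π'.drop (i + 1)) fun e he =>
      hπ e (List.mem_append_left _ (List.mem_of_mem_drop he))
    linarith

lemma IsOpt.le_of_isGrowth (hT : I.IsOpt B T) (hL : IsGrowth I.graph I.root L)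
    (hB : (L.map I.cost).sum ≤ B) : totalPrize I.prize (I.span L) ≤ totalPrize I.prize T :=
  hT.2 _ hL.isRootedSubtree ((totalCost_edgeSpan_list hL.nodup hL.subset).trans_le hB)

variable [Finite V] [Finite E]

/-- Every vertex is joined to the root by edges of total cost at most the eccentricity. -/
lemma exists_joined_of_mem (hv : v ∈ I.graph.vertexSet) : ∃ P : List E,
    (∀ e ∈ P, e ∈ I.graph.edgeSet) ∧ Joined I.graph {e | e ∈ P} I.root v ∧
      (P.map I.cost).sum ≤ I.eccentricity := by
  have := Fintype.ofFinite V
  obtain ⟨L, hL, hspan⟩ := I.exists_spanning_isGrowth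
  obtain ⟨w₀, hw₀, -⟩ := hL.exists_isPath v (hspan v hv)
  -- Paths have bounded length, so there are finitely many and the infimum defining the distance is
  -- attained.
  have hfin : {x | ∃ w, IsPath I.graph I.root w v ∧ x = (w.map fun s => I.cost s.1).sum}.Finite := by
    have h1 : {w | IsPath I.graph I.root w v}.Finite := by
      refine (List.finite_length_le (E × V) (Fintype.card V)).subset fun w hw => ?_
      have := (List.nodup_cons.1 hw.2).2.length_le_card
      simpa using this
    refine (h1.image fun w => (w.map fun s => I.cost s.1).sum).subset ?_
    rintro _ ⟨w, hw, rfl⟩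
    exact ⟨w, hw, rfl⟩
  obtain ⟨w, hw, hd⟩ := Set.Nonempty.csInf_mem (show Set.Nonempty {x | ∃ w, IsPath I.graph I.root w v ∧
    x = (w.map fun s => I.cost s.1).sum} from ⟨_, w₀, hw₀, rfl⟩) hfin
  refine ⟨w.map Prod.fst, hw.1.mem_edgeSet, hw.1.joined, ?_⟩
  rw [List.map_map]
  refine le_of_eq_of_le hd.symm (le_csSup ?_ ⟨v, hv, rfl⟩)
  exact ((Set.toFinite I.graph.vertexSet).image _).bddAbove

lemma eccentricity_nonneg : 0 ≤ I.eccentricity := by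
  obtain ⟨P, hP, -, hle⟩ := exists_joined_of_mem I.root_mem
  exact (cost_list_nonneg hP).trans hle

lemma eccentricity_pos (hv : v ∈ I.graph.vertexSet) (hvr : v ≠ I.root) : 0 < I.eccentricity := by
  obtain ⟨P, hP, hj, hle⟩ := exists_joined_of_mem hv
  refine lt_of_lt_of_le (List.sum_pos _ (by simpa using fun e he => I.cost_pos e (hP e he)) ?_) hle
  intro h
  rw [List.map_eq_nil_iff] at h
  subst h
  rcases hj.cases_head with h | ⟨_, ⟨e, he, -⟩, -⟩
  · exact hvr h.symm
  · simp at he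

lemma exists_isOpt (hB : 0 ≤ B) : ∃ T, I.IsOpt B T := by
  obtain ⟨T, hT, hT'⟩ := Set.exists_max_image
    {T | IsRootedSubtree I.graph I.root T ∧ totalCost I.cost T ≤ B} (totalPrize I.prize)
    (Set.toFinite _) ⟨_, (IsGrowth.nil I.root_mem).isRootedSubtree, by
      rw [totalCost_edgeSpan_list (by simp) (by simp)]
      simpa using hB⟩
  exact ⟨T, hT, fun T' h h' => hT' T' ⟨h, h'⟩⟩

/-- The cost bound is the geometric sum `1 + 2 + ⋯ + 2 ^ i = 2 ^ (i + 1) - 1`; coverage holds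
because skipped edges lose no vertices. -/
lemma ScalingStep.isGoodState {s s' : ℕ × List E} (h : I.ScalingStep s s') (hs : I.IsGoodState s) :
    I.IsGoodState s' := by
  obtain ⟨-, T, ρ, hT, hρ, rfl⟩ := h
  obtain ⟨h1, h2, h3⟩ := hs
  have hTr := hT.1.1
  have hρT := hρ.isGrowth hTr.2.2
  obtain ⟨f1, f2, f3, f4⟩ := foldl_appendEdge h1 (hρT.mono hTr.1)
  have hcost : ((ρ.foldl I.appendEdge s.2).map I.cost).sum ≤
      (2 ^ (s.1 + 1) - 1) * I.eccentricity := by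
    have h4 := list_sum_le_totalCost (fun e he => (isRootedSubtree_pos hTr e he).le)
      hρT.nodup hρT.subset
    have h5 := hT.1.2
    rw [pow_succ]
    linarith
  refine ⟨f1, hcost, fun j hj => ?_⟩
  rcases (Nat.lt_succ_iff.1 hj).lt_or_eq with hj | rfl
  · obtain ⟨π, T, hp, h⟩ := h3 j hj
    exact ⟨π, T, hp.trans f2, h⟩
  · refine ⟨_, T, List.prefix_rfl, hcost, hT, fun v hv hpv => f3 ?_⟩
    rcases hρ.2.mem_edgeSpan (isRootedSubtree_nonneg hTr) hv hpv with h | ⟨e, he, hi⟩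
    · exact Or.inl h
    · exact Or.inr ⟨e, he, hi.mono hTr.1⟩

lemma isGoodState_of_reflTransGen {s : ℕ × List E} (h : ReflTransGen I.ScalingStep (0, []) s) :
    I.IsGoodState s := by
  induction h with
  | refl => exact isGoodState_zero
  | tail _ h ih => exact h.isGoodState ih

lemma spansPrizes_of_eccentricity_eq_zero (h : I.eccentricity = 0) : I.SpansPrizes π := by
  intro v hv _
  by_contra hcon
  exact (eccentricity_pos hv fun h => hcon (Or.inl h)).ne' h

/-- A spanning tree fits into such a budget and would beat an optimum that misses a positive prize.
-/
lemma IsOpt.mem_of_totalCost_le (hT : I.IsOpt B T) (hB : totalCost I.cost I.graph ≤ B)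
    (hv : v ∈ I.graph.vertexSet) (hpv : 0 < I.prize v) : v ∈ T.vertexSet := by
  classical
  by_contra hcon
  obtain ⟨L, hL, hspan⟩ := I.exists_spanning_isGrowth
  have h1 := hT.le_of_isGrowth hL ((list_sum_le_totalCost (fun e he => (I.cost_pos e he).le)
    hL.nodup hL.subset).trans hB)
  have h2 : ∑ w ∈ insert v T.vertexSet.toFinite.toFinset, I.prize w ≤
      totalPrize I.prize (I.span L) := by
    refine sum_le_totalPrize (isRootedSubtree_nonneg hL.isRootedSubtree) fun w hw _ => hspan w ?_
    rcases Finset.mem_insert.1 hw with rfl | hw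
    · exact hv
    · exact hT.1.1.1.1 (by simpa using hw)
  rw [Finset.sum_insert (by simpa using hcon), ← totalPrize_eq_sum] at h2
  linarith

variable (I) in
lemma scalingTerminates : I.ScalingTerminates := by
  have hgreedy : ∀ T, IsRootedSubtree I.graph I.root T →
      AlwaysHalts (GreedyStep T I.cost I.prize I.root) (GreedyHalt T I.prize I.root) [] :=
    fun T hT => alwaysHalts_greedy hT.2.1.1 hT.2.2 (isRootedSubtree_pos hT)
      (isRootedSubtree_nonneg hT)
  refine ⟨⟨?_, ?_⟩, hgreedy⟩
  · rintro ⟨s, h0, hs⟩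
    have hidx : ∀ n, (s n).1 = n ∧ I.IsGoodState (s n) := by
      intro n
      induction n with
      | zero => rw [h0]; exact ⟨rfl, isGoodState_zero⟩
      | succ n ih =>
        refine ⟨?_, (hs n).isGoodState ih.2⟩
        obtain ⟨-, T, ρ, -, -, h⟩ := hs n
        rw [h, ih.1]
    have hχ : 0 < I.eccentricity := by
      refine lt_of_le_of_ne eccentricity_nonneg fun h => ?_
      exact (hs 0).1 (spansPrizes_of_eccentricity_eq_zero h.symm)
    -- By phase `n` the budget exceeds the cost of the whole graph, so that phase collects all
    -- prizes and the run cannot go on.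
    obtain ⟨n, hn⟩ := pow_unbounded_of_one_lt (totalCost I.cost I.graph / I.eccentricity)
      (one_lt_two : (1 : ℝ) < 2)
    rw [div_lt_iff₀ hχ] at hn
    obtain ⟨hi, -, -, hcover⟩ := hidx (n + 1)
    obtain ⟨π, T, hπ, -, hT, hTπ⟩ := hcover n (by omega)
    refine (hs (n + 1)).1 fun v hv hpv => ?_
    exact edgeSpan_vertexSet_mono (fun f hf => hπ.subset hf)
      (hTπ v (hT.mem_of_totalCost_le hn.le hv hpv) hpv)
  · intro s _
    by_cases h : I.SpansPrizes s.2
    · exact Or.inl h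
    · obtain ⟨T, hT⟩ := exists_isOpt (I := I) (B := 2 ^ s.1 * I.eccentricity)
        (mul_nonneg (by positivity) eccentricity_nonneg)
      obtain ⟨ρ, hρ⟩ := (hgreedy T hT.1.1).exists_halt
      exact Or.inr ⟨_, h, T, ρ, hT, hρ, rfl⟩

/-! ### Comparison of optima and the competitive ratio. -/

open Classical in
/-- The prize of an optimum for budget `B` compared with that for a smaller budget. -/
lemma IsOpt.compare {m : ℝ} {ℓ : ℕ} {T' : Graph V E} (hT : IsRootedSubtree I.graph I.root T)
    (hTB : totalCost I.cost T ≤ 4 * ((m - ℓ) * I.eccentricity)) (hχ : 0 < I.eccentricity)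
    (hm : ℓ < m) (hT' : I.IsOpt (m * I.eccentricity) T') :
    (1 - (1 / 2) ^ ℓ) * totalPrize I.prize T ≤ 4 * totalPrize I.prize T' := by
  obtain ⟨L, hL, hLT⟩ := hT.exists_isGrowth
  obtain ⟨L', W, hp, hA, hW⟩ := hL.exists_arborescence
  have hW' : ∀ v, v ∈ W ↔ v ∈ T.vertexSet := fun v => by rw [hW, hLT]
  set M := (m - ℓ) * I.eccentricity with hMdef
  have hM : 0 < M := mul_pos (by linarith) hχ
  have hL'T : ∀ e ∈ L', e ∈ T.edgeSet := fun e he => hL.subset e (hp.mem_iff.1 he)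
  have hL'G : ∀ e ∈ L', e ∈ I.graph.edgeSet := fun e he => hT.1.edgeSet_mono (hL'T e he)
  have hmax : ∀ e ∈ I.graph.edgeSet, max (I.cost e) 0 = I.cost e := fun e he =>
    max_eq_left (I.cost_pos e he).le
  -- Costs and prizes are unconstrained outside the graph, whereas the decomposition wants them
  -- non-negative everywhere; hence the truncations.
  obtain ⟨F, U, S, hF, hS, hj, hFc, hU⟩ := hA.exists_parts ℓ (c := fun e => max (I.cost e) 0)
    (p := fun v => if v ∈ T.vertexSet then I.prize v else 0) (M := M) (D := 4 * M)
    (fun e => le_max_right _ _)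
    (fun v => by
      split_ifs with h
      exacts [isRootedSubtree_nonneg hT v h, le_rfl])
    (by
      rw [List.map_congr_left fun e he => hmax e (hL'G e he)]
      refine le_trans ?_ hTB
      exact list_sum_le_totalCost (fun e he => (isRootedSubtree_pos hT e he).le)
        (hp.nodup_iff.2 hL.nodup) hL'T)
    hM.le (by linarith)
  rw [Finset.sum_congr rfl fun v hv => if_pos ((hW' v).1 hv), ← Finset.sum_filter] at hU
  have hWT : W = T.vertexSet.toFinite.toFinset := by
    ext v
    simp [hW']
  rw [hWT, ← totalPrize_eq_sum] at hU
  have hpath : ∀ v, ∃ P : List E, (∀ e ∈ P, e ∈ I.graph.edgeSet) ∧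
      (v ∈ I.graph.vertexSet → Joined I.graph {e | e ∈ P} I.root v) ∧
      (P.map I.cost).sum ≤ I.eccentricity := by
    intro v
    by_cases hv : v ∈ I.graph.vertexSet
    · obtain ⟨P, h1, h2, h3⟩ := exists_joined_of_mem hv
      exact ⟨P, h1, fun _ => h2, h3⟩
    · exact ⟨[], by simp, fun h => (hv h).elim, by simpa using hχ.le⟩
  choose P hPG hPj hPc using hpath
  -- The parts together with one cheapest root path to each of their at most `ℓ` base points cost at
  -- most `M + ℓχ = mχ`. These edges may contain cycles, so a tree is extracted from them.
  set K := F ∪ S.biUnion fun v => (P v).toFinset with hK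
  have hc0 : ∀ e, 0 ≤ max (I.cost e) 0 := fun e => le_max_right _ _
  have hKc : ∑ e ∈ K, max (I.cost e) 0 ≤ m * I.eccentricity := by
    have h1 := sum_union_le hc0 F (S.biUnion fun v => (P v).toFinset)
    have h2 : ∑ e ∈ S.biUnion fun v => (P v).toFinset, max (I.cost e) 0 ≤
        ∑ v ∈ S, ∑ e ∈ (P v).toFinset, max (I.cost e) 0 := by
      clear_value K
      clear hj hS h1 hK
      induction S using Finset.induction_on with
      | empty => simp
      | insert a S ha ih =>
        rw [Finset.biUnion_insert, Finset.sum_insert ha]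
        exact (sum_union_le hc0 _ _).trans (by linarith)
    have h3 : ∑ v ∈ S, ∑ e ∈ (P v).toFinset, max (I.cost e) 0 ≤ S.card • I.eccentricity := by
      refine Finset.sum_le_card_nsmul _ _ _ fun v _ => ?_
      refine (sum_toFinset_le hc0 (P v)).trans ?_
      rw [List.map_congr_left fun e he => hmax e (hPG v e he)]
      exact hPc v
    have h4 : (S.card : ℝ) * I.eccentricity ≤ ℓ * I.eccentricity :=
      mul_le_mul_of_nonneg_right (by exact_mod_cast hS) hχ.le
    rw [nsmul_eq_mul] at h3
    linarith
  obtain ⟨L₀, hL₀, hL₀K, hspan⟩ := exists_isGrowth I.root_mem (K : Set E)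
  have hL₀c : (L₀.map I.cost).sum ≤ m * I.eccentricity := by
    refine le_trans ?_ hKc
    rw [← List.map_congr_left fun e he => hmax e (hL₀.subset e he), ← List.sum_toFinset _ hL₀.nodup]
    exact Finset.sum_le_sum_of_subset_of_nonneg (fun e he => hL₀K e (by simpa using he))
      fun e _ _ => hc0 e
  have hcollect : ∑ v ∈ U with v ∈ T.vertexSet, I.prize v ≤ totalPrize I.prize (I.span L₀) := by
    refine sum_le_totalPrize (isRootedSubtree_nonneg hL₀.isRootedSubtree) fun w hw _ => hspan w ?_
    obtain ⟨hwU, hwT⟩ := Finset.mem_filter.1 hw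
    obtain ⟨v, hvS, hvw⟩ := hj w hwU
    have hvw := hvw.mono_graph hT.1
    have hv : v ∈ I.graph.vertexSet := hvw.symm.mem (hT.1.1 hwT)
    refine ((hPj v hv).mono fun e he => ?_).trans
      (hvw.mono (Finset.coe_subset.2 Finset.subset_union_left))
    exact Finset.mem_coe.2 (Finset.mem_union_right _ (Finset.mem_biUnion.2 ⟨v, hvS, by simpa using he⟩))
  have hopt := hT'.le_of_isGrowth hL₀ hL₀c
  refine le_of_mul_le_mul_left ?_ hM
  have := mul_le_mul_of_nonneg_left (hcollect.trans hopt) (show 0 ≤ 4 * M by linarith)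
  linarith

lemma ScalingOutput.isIncrementalSolution (h : I.ScalingOutput π) : I.IsIncrementalSolution π := by
  obtain ⟨i, hi, hspan⟩ := h
  have hg := (isGoodState_of_reflTransGen hi).1
  exact ⟨hg.nodup, hg.subset, fun j _ => (hg.take j).isRootedSubtree, hspan⟩

lemma ScalingOutput.le_alg (h : I.ScalingOutput π) {ℓ : ℕ} (hℓ : 1 ≤ ℓ) (hB : 0 ≤ B)
    (hT : I.IsOpt B T) : totalPrize I.prize T ≤ 2 ^ (ℓ + 2) / (2 ^ ℓ - 1) *
      totalPrize I.prize (I.alg π (B + (4 * (ℓ : ℝ) - 1) * I.eccentricity)) := by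
  obtain ⟨i, hi, hspan⟩ := h
  obtain ⟨hg, hcost, hprefix⟩ := isGoodState_of_reflTransGen hi
  dsimp only at hg hcost hprefix
  set A := I.alg π (B + (4 * (ℓ : ℝ) - 1) * I.eccentricity)
  have hA0 : ∀ v ∈ A.vertexSet, 0 ≤ I.prize v := fun v hv =>
    I.prize_nonneg v (alg_vertexSet_subset hv)
  have hℓ' : (1 : ℝ) ≤ ℓ := by exact_mod_cast hℓ
  have hpow : (2 : ℝ) ≤ 2 ^ ℓ := le_self_pow₀ (by norm_num) (by omega)
  have hden : (0 : ℝ) < 2 ^ ℓ - 1 := by linarith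
  have hpA := totalPrize_nonneg hA0
  rw [div_mul_eq_mul_div, le_div_iff₀ hden, pow_add]
  -- If the bound on the entire solution fits into the budget, all positive prizes are collected.
  -- This also settles `χ = 0`, and otherwise guarantees that the phase `j` chosen below was
  -- executed.
  rcases le_or_gt ((2 ^ i - 1) * I.eccentricity) (B + (4 * (ℓ : ℝ) - 1) * I.eccentricity)
    with hcase | hcase
  · have h1 : totalPrize I.prize T ≤ totalPrize I.prize A :=
      totalPrize_le hA0 fun v hv hpv => span_subset_alg hg.subset List.prefix_rfl
        (hcost.trans hcase) (hspan v (hT.1.1.1.1 hv) hpv)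
    have h2 := mul_le_mul_of_nonneg_right h1 hden.le
    nlinarith [mul_nonneg hpA hden.le]
  have hχ : 0 < I.eccentricity := by
    refine lt_of_le_of_ne eccentricity_nonneg fun h => ?_
    rw [← h] at hcase
    linarith
  obtain ⟨k, hk1, hk2⟩ := exists_nat_pow_near
    (show 1 ≤ B / I.eccentricity + 4 * ℓ by linarith [div_nonneg hB hχ.le]) one_lt_two
  -- Since `ℓ ≥ 1`, the number lies above `2`, so the exponent can be written as `j + 1`.
  have hk0 : k ≠ 0 := by
    rintro rfl
    norm_num at hk2
    linarith [div_nonneg hB hχ.le]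
  obtain ⟨j, rfl⟩ := Nat.exists_eq_add_one_of_ne_zero hk0
  have hBχ : B / I.eccentricity * I.eccentricity = B := div_mul_cancel₀ _ hχ.ne'
  have hki : j < i := by
    have h1 : B / I.eccentricity + 4 * ℓ < 2 ^ i := by
      refine lt_of_mul_lt_mul_right ?_ hχ.le
      linarith
    have := (pow_lt_pow_iff_right₀ (one_lt_two : (1 : ℝ) < 2)).1 (hk1.trans_lt h1)
    omega
  obtain ⟨π', T', hπ', hcost', hT', hcover⟩ := hprefix j hki
  have hA : totalPrize I.prize T' ≤ totalPrize I.prize A := by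
    refine totalPrize_le hA0 fun v hv hpv => span_subset_alg hg.subset hπ' (hcost'.trans ?_)
      (hcover v hv hpv)
    have := mul_le_mul_of_nonneg_right hk1 hχ.le
    linarith
  have hBlt : B < 4 * ((2 ^ j - ℓ) * I.eccentricity) := by
    have := mul_lt_mul_of_pos_right hk2 hχ
    rw [pow_succ, pow_succ] at this
    linarith
  -- Otherwise the strict bound on `B` would make it negative.
  have hm : (ℓ : ℝ) < 2 ^ j := by
    by_contra! hcon
    linarith [mul_nonpos_of_nonpos_of_nonneg (sub_nonpos.2 hcon) hχ.le]
  have hcmp := IsOpt.compare hT.1.1 (hT.1.2.trans hBlt.le) hχ hm hT'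
  have h3 : (1 - (1 / 2 : ℝ) ^ ℓ) * 2 ^ ℓ = 2 ^ ℓ - 1 := by
    rw [sub_mul, ← mul_pow]
    norm_num
  rw [← h3]
  have h4 := mul_le_mul_of_nonneg_right (hcmp.trans (mul_le_mul_of_nonneg_left hA (by norm_num)))
    (show (0 : ℝ) ≤ 2 ^ ℓ by positivity)
  linarith

end Instance

end

end PrizeCollecting

theorem mainTheorem6 {V E : Type*} [Finite V] [Finite E] (I : PrizeCollecting.Instance V E) :
    I.ScalingTerminates ∧
      ∀ ℓ : ℕ, 1 ≤ ℓ →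
        I.IsCompetitive I.ScalingOutput
          ((4 * (ℓ : ℝ) - 1) * I.eccentricity) (2 ^ (ℓ + 2) / (2 ^ ℓ - 1)) := by
  refine ⟨I.scalingTerminates, fun ℓ hℓ => ⟨?_, ?_, ?_, fun π hπ =>
    ⟨hπ.isIncrementalSolution, fun B hB T hT => hπ.le_alg hℓ hB hT⟩⟩⟩
  · have hℓ' : (1 : ℝ) ≤ ℓ := by exact_mod_cast hℓ
    exact mul_nonneg (by linarith) PrizeCollecting.Instance.eccentricity_nonneg
  · have hpow : (2 : ℝ) ≤ 2 ^ ℓ := le_self_pow₀ (by norm_num) (by omega)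
    rw [le_div_iff₀ (by linarith), pow_add]
    linarith
  · obtain ⟨s, hs, hspan⟩ := I.scalingTerminates.1.exists_halt
    exact ⟨s.2, s.1, hs, hspan⟩
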